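/- **Model.** $n\ge 2$ packets are active at the start; $n$ is not known to them and they have no identifiers. Time is divided into slots, and in each slot every active packet independently either sends or listens. A slot is empty, a success or a collision if $0$, $1$ or at least $2$ packets send in it. At the end of the slot all packets learn which case occurred, and a packet that was sent alone has succeeded and terminates immediately. The *makespan* is the number of slots until all $n$ packets have succeeded. The *collision cost* is $\mathcal C$ times the number of collisions in the whole execution, where $\mathcal C\ge 1$ is a real number known to the packets. **Collision-Aversion Backoff (CAB)** with constants $c,d>0$. All packets start with the window size $w=\mathcal C$ and repeat the following. * *Collect-Sample:* for $\lceil d\sqrt{\mathcal C}\ln w\rceil$ slots (no slot if $\ln w\le 0$) every packet sends with probability $1/w$. Let $s$ and $k$ be the numbers of successes and of collisions in these slots. * *Diagnosis:* if $s>\frac{2d\ln w}{10^5}$, then: if $s\le\frac{d\ln w}{20e}$ and $k<\frac{d\sqrt{\mathcal C}\ln w}{8e^2}$, execute RunDown; otherwise replace $w$ by $2w$. If $s\le\frac{2d\ln w}{10^5}$, then: if $k\ge\frac{d\sqrt{\mathcal C}\ln w}{8e^2}$, replace $w$ by $2w$; otherwise replace $w$ by $w/2$. * *RunDown:* let $w_0=w$.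 While $w\ge 8\sqrt{\mathcal C}\log_2 w_0$, every packet sends with probability $2/w$ in each of $\lceil w\rceil$ slots, and then $w$ is replaced by $w/2$. Afterwards, $\lceil c\ln w_0\rceil$ times, every packet sends with probability $2/w_0$ in each of $\lceil w_0\rceil$ slots. (A probability above $1$ is read as $1$.) **Theorem 1.** Let $\kappa\ge 0$ and $A\ge 1$. There are constants $d_0,c_0$ such that for all $d\ge d_0$ and $c\ge c_0$ there are constants $K_1,K_2,K_3$ such that, for all $n\ge 2$ and all real $\mathcal C$ with $1\le\mathcal C\le n^\kappa$, CAB with the constants $c,d$ satisfies the following. Let $G$ be the event that all $n$ packets succeed and the makespan is at most $K_1\,n\sqrt{\mathcal C}\,\log n$. Then $$\Pr[G]\ \ge\ 1-\frac{K_2}{n^{A}}\qquad\text{and}\qquad \mathbb E[\text{collision cost}\mid G]\ \le\ K_3\,n\sqrt{\mathcal C}\,\log^2 n$$ (where the conditional expectation is read as $0$ if $\Pr[G]=0$). That is, with high probability in $n$ all packets succeed with makespan $O(n\sqrt{\mathcal C}\log n)=\tilde O(n\sqrt{\mathcal C})$, and, with high probability in the sense that executions of total probability $O(n^{-A})$ are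 left out of the expectation, the expected collision cost is $O(n\sqrt{\mathcal C}\log^2 n)=\tilde O(n\sqrt{\mathcal C})$. -/

import Mathlib

open MeasureTheory ProbabilityTheory
open scoped ENNReal

namespace ContentionResolution

/-! ### The multiple access channel -/

/-- Ternary channel feedback of a slot. -/
inductive Feedback where
  | empty
  | success
  | collision
  deriving DecidableEq

/-- A protocol, executed separately by every packet. A packet in local state `s` sends in the
current slot with probability `sendProb s` (values above `1` mean that it sends surely) and listens
otherwise; at the end of the slot it moves to a new local state that depends only on the channel
feedback. The protocol has no access to the number of packets or to an identity of the packet. -/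
structure Protocol where
  State : Type
  start : State
  sendProb : State → ℝ
  next : State → Feedback → State

/-- The situation of `n` packets: `none` means that the packet has succeeded and terminated,
`some s` that it is active with local state `s`. -/
abbrev Config (P : Protocol) (n : ℕ) : Type := Fin n → Option P.State

/-- The coins of an execution: one number in `[0, 1]` for each slot and each packet. -/
abbrev Coins (n : ℕ) : Type := ℕ → Fin n → unitInterval

/-- All coins are independent and uniformly distributed on `[0, 1]`. -/
noncomputable def coinMeasure (n : ℕ) : Measure (Coins n) :=
  Measure.infinitePi fun _ : ℕ => Measure.pi fun _ : Fin n => (volume : Measure unitInterval)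

section Execution

variable (P : Protocol) {n : ℕ}

open Classical in
/-- The active packets that send in a slot in which the coins are `u`. -/
noncomputable def senders (x : Config P n) (u : Fin n → unitInterval) : Finset (Fin n) :=
  Finset.univ.filter fun i => ∃ s, x i = some s ∧ (u i : ℝ) < P.sendProb s

/-- The channel feedback of a slot with set of senders `S`. -/
def feedback (S : Finset (Fin n)) : Feedback :=
  if S.card = 0 then .empty else if S.card = 1 then .success else .collision

/-- One slot: a packet that is sent alone succeeds and terminates; every other active packet
updates its local state according to the feedback. -/
noncomputable def step (x : Config P n) (u : Fin n → unitInterval) : Config P n := fun i =>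
  if i ∈ senders P x u ∧ feedback (senders P x u) = .success then none
  else (x i).map fun s => P.next s (feedback (senders P x u))

/-- The configuration after `t` slots. -/
noncomputable def config (ω : Coins n) : ℕ → Config P n
  | 0 => fun _ => some P.start
  | t + 1 => step P (config ω t) (ω t)

/-- The feedback of the `t`-th slot, `t = 0, 1, 2, …`. -/
noncomputable def slotFeedback (ω : Coins n) (t : ℕ) : Feedback :=
  feedback (senders P (config P ω t) (ω t))

/-- The makespan: the number of slots until all packets have succeeded (`⊤` if this never
happens). -/
noncomputable def makespan (ω : Coins n) : ℕ∞ :=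
  ⨅ (t : ℕ) (_ : ∀ i, config P ω t i = none), (t : ℕ∞)

/-- The collision cost of the whole execution: the number of collisions multiplied by `C`. -/
noncomputable def collisionCost (C : ℝ) (ω : Coins n) : ℝ≥0∞ :=
  ENNReal.ofReal C * (({t : ℕ | slotFeedback P ω t = .collision}.encard : ℕ∞) : ℝ≥0∞)

end Execution

/-! ### Collision-Aversion Backoff -/

namespace CAB

/-- The actions that Diagnosis can choose. -/
inductive Decision where
  | double
  | halve
  | runDown

open Classical in
/-- Diagnosis, from the numbers of successes and collisions in a sample with window size `w`. -/
noncomputable def diagnosis (C d : ℝ) (successes collisions : ℕ) (w : ℝ) : Decision :=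
  if (successes : ℝ) > 2 * d * Real.log w / 10 ^ 5 then
    if (successes : ℝ) ≤ d * Real.log w / (20 * Real.exp 1) then
      if (collisions : ℝ) ≥ d * √C * Real.log w / (8 * Real.exp 1 ^ 2) then .double
      else .runDown
    else .double
  else
    if (collisions : ℝ) ≥ d * √C * Real.log w / (8 * Real.exp 1 ^ 2) then .double
    else .halve

/-- The number of slots of a sample. -/
noncomputable def sampleLength (C d w : ℝ) : ℕ := ⌈d * √C * Real.log w⌉₊

/-- A sample is empty exactly for window sizes up to `1`. -/
theorem sampleLength_eq_zero_iff {C d w : ℝ} (hC : 1 ≤ C) (hd : 0 < d) (hw : 0 < w) :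
    sampleLength C d w = 0 ↔ w ≤ 1 := by
  have h : 0 < d * √C := mul_pos hd (Real.sqrt_pos.2 (by linarith))
  rw [sampleLength, Nat.ceil_eq_zero, ← Real.log_nonpos_iff hw.le]
  constructor
  · intro h1
    by_contra h2
    exact absurd h1 (not_le.2 (mul_pos h (not_le.1 h2)))
  · intro h1
    exact mul_nonpos_of_nonneg_of_nonpos h.le h1

/-- After an empty sample, Diagnosis doubles the window. -/
theorem diagnosis_of_le_one {C d w : ℝ} (hd : 0 < d) (hw : 0 < w) (hw1 : w ≤ 1) :
    diagnosis C d 0 0 w = .double := by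
  have hl : Real.log w ≤ 0 := Real.log_nonpos hw.le hw1
  have hc : ((0 : ℕ) : ℝ) ≥ d * √C * Real.log w / (8 * Real.exp 1 ^ 2) := by
    rw [Nat.cast_zero]
    exact div_nonpos_of_nonpos_of_nonneg
      (mul_nonpos_of_nonneg_of_nonpos (mul_nonneg hd.le (Real.sqrt_nonneg _)) hl) (by positivity)
  unfold diagnosis
  simp only [if_pos hc]
  split_ifs <;> rfl

/-- The local state of a packet at the beginning of a slot.

* `sample w left s k`: in Collect-Sample with window size `w`, with `left` slots of the sample
  still to come, `s` successes and `k` collisions counted so far;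
* `run w₀ w left`: in the while-loop of RunDown started with window size `w₀`, with `left` slots of
  the current window of size `w` still to come;
* `finish w₀ w left`: in the final windows of size `w₀` of RunDown, with `left` slots in all of them
  together still to come, the current window size having been left at `w` by the while-loop. -/
inductive State where
  | sample (w : ℝ) (left s k : ℕ)
  | run (w₀ w : ℝ) (left : ℕ)
  | finish (w₀ w : ℝ) (left : ℕ)

/-- Start Collect-Sample with window size `w`. Empty samples take no slot and lead to a doubling of
the window (see `sampleLength_eq_zero_iff`, `diagnosis_of_le_one`), so that the next slot belongs to
a sample whose window size is the first one among `w, 2w, 4w, …` that exceeds `1`. -/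
noncomputable def beginSample (C d w : ℝ) : State :=
  let w' := 2 ^ sInf {k : ℕ | 1 < 2 ^ k * w} * w
  .sample w' (sampleLength C d w') 0 0

open Classical in
/-- The test of the while-loop of RunDown: another window of size `w`, or the final `c ln w₀`
windows of size `w₀`. -/
noncomputable def beginRun (C c w₀ w : ℝ) : State :=
  if w ≥ 8 * √C * Real.logb 2 w₀ then .run w₀ w ⌈w⌉₊
  else .finish w₀ w (⌈c * Real.log w₀⌉₊ * ⌈w₀⌉₊)

/-- What follows a complete sample. -/
noncomputable def afterSample (C c d : ℝ) (s k : ℕ) (w : ℝ) : State :=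
  match diagnosis C d s k w with
  | .double => beginSample C d (2 * w)
  | .halve => beginSample C d (w / 2)
  | .runDown => beginRun C c w w

/-- The probability with which a packet sends. -/
noncomputable def sendProb : State → ℝ
  | .sample w _ _ _ => 1 / w
  | .run _ w _ => 2 / w
  | .finish w₀ _ _ => 2 / w₀

/-- The new local state at the end of a slot. -/
noncomputable def next (C c d : ℝ) : State → Feedback → State
  | .sample w left s k, f =>
      let s' := if f = .success then s + 1 else s
      let k' := if f = .collision then k + 1 else k
      if left ≤ 1 then afterSample C c d s' k' w else .sample w (left - 1) s' k'
  | .run w₀ w left, _ => if left ≤ 1 then beginRun C c w₀ (w / 2) else .run w₀ w (left - 1)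
  | .finish w₀ w left, _ => if left ≤ 1 then beginSample C d w else .finish w₀ w (left - 1)

end CAB

/-- Collision-Aversion Backoff for collision cost `C`, with the constants `d` (sample size) and `c`
(number of final windows). The initial window size is `C`. -/
noncomputable def collisionAversionBackoff (C c d : ℝ) : Protocol where
  State := CAB.State
  start := CAB.beginSample C d C
  sendProb := CAB.sendProb
  next := CAB.next C c d

end ContentionResolution

open ContentionResolution

/-!
All active packets see the same feedback, so they are always in the same local state, and an
execution is described by that state together with the number `m` of active packets. A slot then has
only three outcomes, whose probabilities are explicit (`fbMean`), and the whole question becomes one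
about a Markov chain on pairs (state, `m`). Its analysis is a value iteration: `costToGo P M k s m` is
the expected number of collisions in the next `k` slots plus a penalty `M` if some packet is still
active after them. For a penalty that is a large power of `n`, an upper bound
`O(n log² n / √C)` for the cost-to-go of the start bounds at the same time the expected number of
collisions and the probability that the makespan exceeds `k` (`sum_collisions_add_penalty`,
`bounds_of_costToGo_le`). No cost-to-go of at most `M` slots exceeds `2M`, so an event of probability
`δ = n ^ (-B)` with `B` sufficiently larger than the exponent of `M` can be ignored wherever it occurs.

The protocol consists of blocks of slots with a constant sending probability. Concentration within a
block, during which `m` decreases, is certified by nonnegative supermartingales (`TailBound`), and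
`costToGo_block` combines such a certificate with the cost-to-go after the block. With `X = n √C`:

* As long as `m ≥ 9n/10`, up to an error probability `O(δ)`, a sample with window `w < 4X` leads to a doubling, one with
  `4X ≤ w ≤ 2048X` not to a halving, one with `w ≥ 512X` not to a doubling, and one with `w ≥ 10⁶X`
  not to RunDown. Hence the window moves monotonically until RunDown starts with `w = Θ(X)`
  (`search_up`, `search_down`). For windows below `√n` the tail bounds, of order `w ^ (-Ω(d))`, are too
  weak; there every slot is a collision except with probability `exp (-Ω(√n))`.
* The load of the channel is `n / w`, and `√C · min 1 (n / w) ≤ √n` for all windows that occur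
  (`sqrt_mul_min_le`). Hence a sample has `O(√n log n)` successes, which keeps `m ≥ 9n/10`, and
  `O(n log n / √C)` expected collisions; there are `O(log n)` samples.
* In the loop of RunDown, `m ≤ max (w / (4√C)) Λ` with `Λ = Θ(log n)` is preserved, because the
  number of packets that are left after a window is at most half of the bound `w / (4√C)`, unless that
  bound is below `Λ`. The expected collisions `O(m² / w)` of the windows form a geometric sum
  (`beginRun_le`).
* In each of the `c ln w₀` final windows every packet succeeds with constant probability, so that
  all packets are gone except with probability `n ^ (1 - c)` (`finish_le`).

For the boundedly many `n` that are too small for these estimates the constants `K₂`, `K₃` make both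
bounds trivial.
-/

namespace ContentionResolution

/-! ### The lumped Markov chain -/

/-- Probability that nobody sends if `m` packets send independently with probability `p`. -/
def emptyProb (p : ℝ) (m : ℕ) : ℝ := (1 - p) ^ m

/-- Probability that exactly one packet sends if `m` packets send independently with
probability `p`. -/
def succProb (p : ℝ) (m : ℕ) : ℝ := m * (p * (1 - p) ^ (m - 1))

/-- Probability that at least two packets send if `m` packets send independently with
probability `p`. -/
def collProb (p : ℝ) (m : ℕ) : ℝ := 1 - emptyProb p m - succProb p m

/-- The sending probability of a packet in local state `s`, cut off to `[0, 1]`. -/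
noncomputable def Protocol.prob (P : Protocol) (s : P.State) : ℝ := max 0 (min 1 (P.sendProb s))

lemma Protocol.prob_nonneg (P : Protocol) (s : P.State) : 0 ≤ P.prob s := le_max_left _ _

lemma Protocol.prob_le_one (P : Protocol) (s : P.State) : P.prob s ≤ 1 :=
  max_le zero_le_one (min_le_left _ _)

lemma Protocol.prob_of_mem (P : Protocol) {s : P.State} (h0 : 0 ≤ P.sendProb s)
    (h1 : P.sendProb s ≤ 1) : P.prob s = P.sendProb s := by
  rw [Protocol.prob, min_eq_right h1, max_eq_right h0]

lemma emptyProb_nonneg {p : ℝ} (h1 : p ≤ 1) (m : ℕ) : 0 ≤ emptyProb p m :=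
  pow_nonneg (by linarith) _

lemma succProb_nonneg {p : ℝ} (h0 : 0 ≤ p) (h1 : p ≤ 1) (m : ℕ) : 0 ≤ succProb p m :=
  mul_nonneg (Nat.cast_nonneg _) (mul_nonneg h0 (pow_nonneg (by linarith) _))

/-- Bernoulli's inequality in the form used for the probability of a silent channel. -/
lemma one_sub_mul_le_pow {p : ℝ} (h1 : p ≤ 1) (m : ℕ) : 1 - m * p ≤ (1 - p) ^ m := by
  have := one_add_mul_le_pow (a := -p) (by linarith) m
  calc 1 - m * p = 1 + m * -p := by ring
    _ ≤ _ := this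
    _ = _ := by ring_nf

lemma one_sub_collProb {p : ℝ} {m : ℕ} (hm : 1 ≤ m) :
    1 - collProb p m = (1 - p) ^ (m - 1) * (1 + ((m : ℝ) - 1) * p) := by
  obtain ⟨k, rfl⟩ : ∃ k, m = k + 1 := ⟨m - 1, by omega⟩
  simp only [collProb, emptyProb, succProb, Nat.add_sub_cancel, pow_succ]
  push_cast
  ring

lemma collProb_zero (p : ℝ) : collProb p 0 = 0 := by
  simp [collProb, emptyProb, succProb]

lemma collProb_nonneg {p : ℝ} (h0 : 0 ≤ p) (h1 : p ≤ 1) (m : ℕ) : 0 ≤ collProb p m := by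
  rcases Nat.eq_zero_or_pos m with rfl | hm
  · rw [collProb_zero]
  have h := one_sub_collProb (p := p) hm
  obtain ⟨k, rfl⟩ : ∃ k, m = k + 1 := ⟨m - 1, by omega⟩
  simp only [Nat.add_sub_cancel] at h
  have h2 : (1 - p) ^ k * (1 + (((k + 1 : ℕ) : ℝ) - 1) * p) ≤ (1 - p) ^ k * (1 + p) ^ k := by
    apply mul_le_mul_of_nonneg_left _ (pow_nonneg (by linarith) _)
    have := one_add_mul_le_pow (a := p) (by linarith) k
    push_cast
    linarith
  have h3 : (1 - p) ^ k * (1 + p) ^ k ≤ 1 := by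
    rw [← mul_pow]
    exact pow_le_one₀ (by nlinarith) (by nlinarith)
  linarith

lemma collProb_le_sq {p : ℝ} (h0 : 0 ≤ p) (h1 : p ≤ 1) (m : ℕ) : collProb p m ≤ (m * p) ^ 2 := by
  rcases Nat.eq_zero_or_pos m with rfl | hm
  · simp [collProb_zero]
  have h := one_sub_collProb (p := p) hm
  have h2 := one_sub_mul_le_pow h1 (m - 1)
  rw [Nat.cast_sub hm, Nat.cast_one] at h2
  have hm' : (1 : ℝ) ≤ m := by exact_mod_cast hm
  have h3 : (1 - ((m : ℝ) - 1) * p) * (1 + ((m : ℝ) - 1) * p) ≤ 1 - collProb p m := by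
    rw [h]
    exact mul_le_mul_of_nonneg_right h2 (by nlinarith)
  have h4 : (((m : ℝ) - 1) * p) ^ 2 ≤ (m * p) ^ 2 :=
    pow_le_pow_left₀ (by nlinarith) (by nlinarith) 2
  nlinarith

lemma collProb_le_one {p : ℝ} (h0 : 0 ≤ p) (h1 : p ≤ 1) (m : ℕ) : collProb p m ≤ 1 := by
  have := emptyProb_nonneg h1 m
  have := succProb_nonneg h0 h1 m
  unfold collProb
  linarith

lemma succProb_le_mul {p : ℝ} (h0 : 0 ≤ p) (h1 : p ≤ 1) (m : ℕ) : succProb p m ≤ m * p := by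
  unfold succProb
  have : (1 - p) ^ (m - 1) ≤ 1 := pow_le_one₀ (by linarith) (by linarith)
  exact mul_le_mul_of_nonneg_left (by nlinarith) (Nat.cast_nonneg _)

lemma succProb_le_one {p : ℝ} (h0 : 0 ≤ p) (h1 : p ≤ 1) (m : ℕ) : succProb p m ≤ 1 := by
  have := emptyProb_nonneg h1 m
  have := collProb_nonneg h0 h1 m
  unfold collProb at this
  linarith

/-- The distribution of the channel feedback if `m` packets send with probability `p`. -/
def fbProb (p : ℝ) (m : ℕ) : Feedback → ℝ
  | .empty => emptyProb p m
  | .success => succProb p m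
  | .collision => collProb p m

/-- The mean of `F` under the distribution of the channel feedback. -/
def fbMean (p : ℝ) (m : ℕ) (F : Feedback → ℝ) : ℝ :=
  emptyProb p m * F .empty + succProb p m * F .success + collProb p m * F .collision

lemma fbMean_mono {p : ℝ} (h0 : 0 ≤ p) (h1 : p ≤ 1) (m : ℕ) {F G : Feedback → ℝ}
    (hE : F .empty ≤ G .empty) (hS : m ≠ 0 → F .success ≤ G .success)
    (hC : F .collision ≤ G .collision) : fbMean p m F ≤ fbMean p m G := by
  have a := mul_le_mul_of_nonneg_left hE (emptyProb_nonneg h1 m)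
  have c := mul_le_mul_of_nonneg_left hC (collProb_nonneg h0 h1 m)
  have b : succProb p m * F .success ≤ succProb p m * G .success := by
    rcases Nat.eq_zero_or_pos m with rfl | hm
    · simp [succProb]
    · exact mul_le_mul_of_nonneg_left (hS hm.ne') (succProb_nonneg h0 h1 m)
  unfold fbMean
  linarith

lemma fbMean_const (p : ℝ) (m : ℕ) (a : ℝ) : fbMean p m (fun _ => a) = a := by
  simp only [fbMean, collProb]
  ring

lemma fbMean_add (p : ℝ) (m : ℕ) (F G : Feedback → ℝ) :
    fbMean p m (fun f => F f + G f) = fbMean p m F + fbMean p m G := by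
  simp only [fbMean]
  ring

/-- The number of active packets after a slot. -/
def remaining (m : ℕ) : Feedback → ℕ
  | .success => m - 1
  | _ => m

/-- The cost-to-go of `k` slots from a situation with `m` active packets in local state `s`: the
expected number of collisions plus a penalty `M` if some packet is still active at the end. -/
noncomputable def costToGo (P : Protocol) (M : ℝ) : ℕ → P.State → ℕ → ℝ
  | 0, _, m => if m = 0 then 0 else M
  | k + 1, s, m => collProb (P.prob s) m +
      fbMean (P.prob s) m fun f => costToGo P M k (P.next s f) (remaining m f)

section costToGo

variable {P : Protocol} {M : ℝ}

lemma costToGo_zero_packets (k : ℕ) (s : P.State) : costToGo P M k s 0 = 0 := by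
  induction k generalizing s with
  | zero => simp [costToGo]
  | succ k ih => simp [costToGo, fbMean, remaining, ih, collProb_zero]

lemma costToGo_nonneg (hM : 0 ≤ M) (k : ℕ) (s : P.State) (m : ℕ) : 0 ≤ costToGo P M k s m := by
  induction k generalizing s m with
  | zero => simp only [costToGo]; split_ifs <;> simp [hM]
  | succ k ih =>
    have h0 := P.prob_nonneg s
    have h1 := P.prob_le_one s
    have := fbMean_mono h0 h1 m (F := fun _ => 0)
      (G := fun f => costToGo P M k (P.next s f) (remaining m f))
      (ih _ _) (fun _ => ih _ _) (ih _ _)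
    rw [fbMean_const] at this
    simp only [costToGo]
    have := collProb_nonneg h0 h1 m
    linarith

lemma costToGo_le (hM : 0 ≤ M) (k : ℕ) (s : P.State) (m : ℕ) : costToGo P M k s m ≤ M + k := by
  induction k generalizing s m with
  | zero => simp only [costToGo]; split_ifs <;> simp [hM]
  | succ k ih =>
    have h0 := P.prob_nonneg s
    have h1 := P.prob_le_one s
    have := fbMean_mono h0 h1 m (G := fun _ => M + k)
      (F := fun f => costToGo P M k (P.next s f) (remaining m f))
      (ih _ _) (fun _ => ih _ _) (ih _ _)
    rw [fbMean_const] at this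
    simp only [costToGo]
    have := collProb_le_one h0 h1 m
    push_cast
    linarith

end costToGo

/-! ### Executions as trajectories of the lumped chain -/

section Trajectory

variable (P : Protocol) {n : ℕ}

/-- The active packets of `y.2` that send if all of them are in local state `y.1`. -/
noncomputable def sendSet (y : P.State × Finset (Fin n)) (u : Fin n → unitInterval) :
    Finset (Fin n) :=
  y.2.filter fun i => (u i : ℝ) < P.sendProb y.1

/-- One slot for a common local state `y.1` of the active packets `y.2`. -/
noncomputable def advance (y : P.State × Finset (Fin n)) (u : Fin n → unitInterval) :
    P.State × Finset (Fin n) :=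
  (P.next y.1 (feedback (sendSet P y u)),
    if feedback (sendSet P y u) = .success then y.2 \ sendSet P y u else y.2)

/-- The common local state and the set of active packets after `t` slots. The state component keeps
evolving after all packets have succeeded. -/
noncomputable def traj (ω : Coins n) : ℕ → P.State × Finset (Fin n)
  | 0 => (P.start, Finset.univ)
  | t + 1 => advance P (traj ω t) (ω t)

/-- The configuration with active packets `y.2`, all of them in local state `y.1`. -/
def toConfig (y : P.State × Finset (Fin n)) : Config P n :=
  fun i => if i ∈ y.2 then some y.1 else none

lemma senders_toConfig (y : P.State × Finset (Fin n)) (u : Fin n → unitInterval) :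
    senders P (toConfig P y) u = sendSet P y u := by
  ext i
  by_cases h : i ∈ y.2 <;> simp [senders, sendSet, toConfig, h]

lemma step_toConfig (y : P.State × Finset (Fin n)) (u : Fin n → unitInterval) :
    step P (toConfig P y) u = toConfig P (advance P y u) := by
  funext i
  simp only [step, senders_toConfig, toConfig, advance]
  by_cases hf : feedback (sendSet P y u) = .success
  · by_cases hi : i ∈ y.2 <;> by_cases hs : i ∈ sendSet P y u <;> simp [hf, hi, hs]
  · by_cases hi : i ∈ y.2 <;> simp [hf, hi]

lemma config_eq (ω : Coins n) (t : ℕ) : config P ω t = toConfig P (traj P ω t) := by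
  induction t with
  | zero => funext i; simp [config, traj, toConfig]
  | succ t ih => rw [config, ih, step_toConfig, traj]

lemma slotFeedback_eq (ω : Coins n) (t : ℕ) :
    slotFeedback P ω t = feedback (sendSet P (traj P ω t) (ω t)) := by
  rw [slotFeedback, config_eq, senders_toConfig]

lemma config_none_iff (ω : Coins n) (t : ℕ) :
    (∀ i, config P ω t i = none) ↔ (traj P ω t).2 = ∅ := by
  simp only [config_eq, toConfig, Finset.eq_empty_iff_forall_notMem]
  refine forall_congr' fun i => ?_
  by_cases h : i ∈ (traj P ω t).2 <;> simp [h]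

/-- Only the number of senders matters for the number of active packets, which makes the chain
lumpable. -/
lemma card_advance (y : P.State × Finset (Fin n)) (u : Fin n → unitInterval) :
    (advance P y u).2.card = remaining y.2.card (feedback (sendSet P y u)) := by
  simp only [advance]
  split_ifs with h
  · have hsub : sendSet P y u ⊆ y.2 := Finset.filter_subset _ _
    rw [h, Finset.card_sdiff_of_subset hsub]
    have : (sendSet P y u).card = 1 := by
      unfold feedback at h
      split_ifs at h with h1 h2
      exact h2
    rw [this, remaining]
  · cases hf : feedback (sendSet P y u) <;> simp_all [remaining]

lemma traj_succ_empty (ω : Coins n) {t : ℕ} (h : (traj P ω t).2 = ∅) :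
    (traj P ω (t + 1)).2 = ∅ := by
  simp [traj, advance, h]

lemma traj_empty_mono (ω : Coins n) {t t' : ℕ} (htt : t ≤ t') (h : (traj P ω t).2 = ∅) :
    (traj P ω t').2 = ∅ := by
  induction t', htt using Nat.le_induction with
  | base => exact h
  | succ k _ ih => exact traj_succ_empty P ω ih

lemma slotFeedback_of_empty (ω : Coins n) {t : ℕ} (h : (traj P ω t).2 = ∅) :
    slotFeedback P ω t = .empty := by
  simp [slotFeedback_eq, sendSet, h, feedback]

/-! ### The distribution of one slot -/

lemma volume_lt (q : ℝ) :
    (volume : Measure unitInterval) {u | (u : ℝ) < q} = ENNReal.ofReal (max 0 (min 1 q)) := by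
  rw [unitInterval.volume_apply]
  have : (Subtype.val '' {u : unitInterval | (u : ℝ) < q}) = Set.Icc 0 1 ∩ Set.Iio q := by
    ext x
    simp only [Set.mem_image, Set.mem_ofPred_eq, Subtype.exists, Set.mem_inter_iff, Set.mem_Iio]
    constructor
    · rintro ⟨a, ha, h, rfl⟩; exact ⟨ha, h⟩
    · rintro ⟨ha, h⟩; exact ⟨x, ha, h, rfl⟩
  rw [this]
  rcases le_or_gt q 1 with h | h
  · have : Set.Icc (0 : ℝ) 1 ∩ Set.Iio q = Set.Ico 0 q := by
      ext x; simp only [Set.mem_inter_iff, Set.mem_Icc, Set.mem_Iio, Set.mem_Ico]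
      constructor
      · rintro ⟨⟨a, b⟩, c⟩; exact ⟨a, c⟩
      · rintro ⟨a, b⟩; exact ⟨⟨a, by linarith⟩, b⟩
    rw [this, Real.volume_Ico, sub_zero, min_eq_right h, max_comm, ENNReal.ofReal_max,
      ENNReal.ofReal_zero, max_eq_left (zero_le)]
  · have : Set.Icc (0 : ℝ) 1 ∩ Set.Iio q = Set.Icc 0 1 := by
      ext x; simp only [Set.mem_inter_iff, Set.mem_Icc, Set.mem_Iio]
      constructor
      · rintro ⟨a, _⟩; exact a
      · rintro a; exact ⟨a, by linarith [a.2]⟩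
    rw [this, Real.volume_Icc, min_eq_left h.le, max_eq_right zero_le_one, sub_zero]

lemma volume_not_lt (q : ℝ) : (volume : Measure unitInterval) {u | ¬ (u : ℝ) < q} =
    ENNReal.ofReal (1 - max 0 (min 1 q)) := by
  have hm : MeasurableSet {u : unitInterval | (u : ℝ) < q} :=
    measurableSet_lt measurable_subtype_coe measurable_const
  have : {u : unitInterval | ¬ (u : ℝ) < q} = {u : unitInterval | (u : ℝ) < q}ᶜ := by
    ext u; simp
  rw [this, prob_compl_eq_one_sub hm, volume_lt, ENNReal.ofReal_sub _ (le_max_left _ _),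
    ENNReal.ofReal_one]

/-- The probability that exactly the packets of `S` send. -/
lemma measure_sendSet_eq (y : P.State × Finset (Fin n)) {S : Finset (Fin n)} (hS : S ⊆ y.2) :
    (Measure.pi fun _ : Fin n => (volume : Measure unitInterval)) {u | sendSet P y u = S} =
      ENNReal.ofReal (P.prob y.1 ^ S.card * (1 - P.prob y.1) ^ (y.2.card - S.card)) := by
  classical
  have hset : {u : Fin n → unitInterval | sendSet P y u = S} = Set.univ.pi fun i =>
      if i ∈ S then {u : unitInterval | (u : ℝ) < P.sendProb y.1} else
      if i ∈ y.2 then {u : unitInterval | ¬ (u : ℝ) < P.sendProb y.1} else Set.univ := by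
    ext u
    simp only [Set.mem_ofPred_eq, Set.mem_pi, Set.mem_univ, true_imp_iff, Finset.ext_iff, sendSet,
      Finset.mem_filter]
    refine forall_congr' fun i => ?_
    have := @hS i
    by_cases h1 : i ∈ S <;> by_cases h2 : i ∈ y.2 <;> simp_all
  have hp0 := P.prob_nonneg y.1
  have hp1 : 0 ≤ 1 - P.prob y.1 := by linarith [P.prob_le_one y.1]
  rw [hset, Measure.pi_pi]
  have : ∀ i : Fin n, (volume : Measure unitInterval)
      (if i ∈ S then {u : unitInterval | (u : ℝ) < P.sendProb y.1} else
      if i ∈ y.2 then {u : unitInterval | ¬ (u : ℝ) < P.sendProb y.1} else Set.univ) =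
      (if i ∈ S then ENNReal.ofReal (P.prob y.1) else 1) *
      (if i ∈ y.2 \ S then ENNReal.ofReal (1 - P.prob y.1) else 1) := by
    intro i
    have := @hS i
    by_cases h1 : i ∈ S <;> by_cases h2 : i ∈ y.2 <;>
      simp_all [volume_lt, volume_not_lt, Protocol.prob, -not_lt]
  rw [Finset.prod_congr rfl fun i _ => this i, Finset.prod_mul_distrib, Finset.prod_ite_mem,
    Finset.prod_ite_mem, Finset.univ_inter, Finset.univ_inter, Finset.prod_const, Finset.prod_const,
    Finset.card_sdiff_of_subset hS, ENNReal.ofReal_mul (pow_nonneg hp0 _), ENNReal.ofReal_pow hp0,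
    ENNReal.ofReal_pow hp1]

lemma measurableSet_sendSet (y : P.State × Finset (Fin n)) (B : Set (Finset (Fin n))) :
    MeasurableSet {u | sendSet P y u ∈ B} := by
  classical
  have : {u | sendSet P y u ∈ B} = ⋃ S ∈ B, {u | sendSet P y u = S} := by
    ext u; simp
  rw [this]
  refine MeasurableSet.biUnion (Set.to_countable _) fun S _ => ?_
  have : {u : Fin n → unitInterval | sendSet P y u = S} = ⋂ i : Fin n,
      {u : Fin n → unitInterval | (i ∈ y.2 ∧ (u i : ℝ) < P.sendProb y.1) ↔ i ∈ S} := by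
    ext u
    simp [sendSet, Finset.ext_iff]
  rw [this]
  refine MeasurableSet.iInter fun i => ?_
  have hm : MeasurableSet {u : Fin n → unitInterval | (u i : ℝ) < P.sendProb y.1} :=
    measurableSet_lt (measurable_subtype_coe.comp (measurable_pi_apply i)) measurable_const
  by_cases h1 : i ∈ y.2 <;> by_cases h2 : i ∈ S
  · simpa [h1, h2] using hm
  · convert hm.compl using 1
    ext u
    simp [h1, h2]
  · simp [h1, h2]
  · simp [h1, h2]

/-- The distribution of the channel feedback of a slot. -/
lemma measure_feedback (y : P.State × Finset (Fin n)) (f : Feedback) :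
    (Measure.pi fun _ : Fin n => (volume : Measure unitInterval))
      {u | feedback (sendSet P y u) = f} = ENNReal.ofReal (fbProb (P.prob y.1) y.2.card f) := by
  classical
  set π := Measure.pi fun _ : Fin n => (volume : Measure unitInterval)
  have hp0 := P.prob_nonneg y.1
  have hp1 := P.prob_le_one y.1
  have hE : π {u | feedback (sendSet P y u) = .empty} =
      ENNReal.ofReal (emptyProb (P.prob y.1) y.2.card) := by
    have h1 : {u | feedback (sendSet P y u) = .empty} = {u | sendSet P y u = ∅} := by
      ext u
      simp only [feedback, Set.mem_ofPred_eq, ← Finset.card_eq_zero]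
      split_ifs <;> simp_all
    rw [h1, measure_sendSet_eq P y (Finset.empty_subset _)]
    simp [emptyProb]
  have hS : π {u | feedback (sendSet P y u) = .success} =
      ENNReal.ofReal (succProb (P.prob y.1) y.2.card) := by
    have h1 : {u | feedback (sendSet P y u) = .success} =
        ⋃ i ∈ y.2, {u | sendSet P y u = {i}} := by
      ext u
      simp only [feedback, Set.mem_ofPred_eq, Set.mem_iUnion, exists_prop]
      constructor
      · intro h
        have : (sendSet P y u).card = 1 := by
          split_ifs at h with h1 h2
          exact h2
        obtain ⟨i, hi⟩ := Finset.card_eq_one.1 this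
        refine ⟨i, ?_, hi⟩
        have : i ∈ sendSet P y u := by simp [hi]
        exact (Finset.mem_filter.1 this).1
      · rintro ⟨i, _, hi⟩
        simp [hi]
    rw [h1, measure_biUnion_finset]
    · rw [Finset.sum_congr rfl fun i hi => measure_sendSet_eq P y (Finset.singleton_subset_iff.2 hi)]
      simp only [Finset.card_singleton, pow_one, Finset.sum_const, nsmul_eq_mul, succProb]
      rw [ENNReal.ofReal_mul (Nat.cast_nonneg _), ENNReal.ofReal_natCast]
    · intro i _ j _ hij
      refine Set.disjoint_left.2 fun u hi hj => hij ?_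
      simp only [Set.mem_ofPred_eq] at hi hj
      exact Finset.singleton_injective (hi.symm.trans hj)
    · intro i _
      exact measurableSet_sendSet P y {S | S = {i}}
  cases f with
  | empty => exact hE
  | success => exact hS
  | collision =>
    have hmE : MeasurableSet {u | feedback (sendSet P y u) = .empty} :=
      measurableSet_sendSet P y {S | feedback S = .empty}
    have hmS : MeasurableSet {u | feedback (sendSet P y u) = .success} :=
      measurableSet_sendSet P y {S | feedback S = .success}
    have h1 : {u | feedback (sendSet P y u) = .collision} =
        ({u | feedback (sendSet P y u) = .empty} ∪ {u | feedback (sendSet P y u) = .success})ᶜ := by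
      ext u
      simp only [Set.mem_ofPred_eq, Set.mem_compl_iff, Set.mem_union]
      cases feedback (sendSet P y u) <;> simp
    have hd : Disjoint {u | feedback (sendSet P y u) = .empty}
        {u | feedback (sendSet P y u) = .success} := by
      refine Set.disjoint_left.2 fun u hi hj => ?_
      simp only [Set.mem_ofPred_eq] at hi hj
      simp [hi] at hj
    rw [h1, prob_compl_eq_one_sub (hmE.union hmS), measure_union hd hmS, hE, hS,
      ← ENNReal.ofReal_add (emptyProb_nonneg hp1 _) (succProb_nonneg hp0 hp1 _),
      ← ENNReal.ofReal_one, ← ENNReal.ofReal_sub _ (add_nonneg (emptyProb_nonneg hp1 _)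
        (succProb_nonneg hp0 hp1 _))]
    simp only [fbProb, collProb]
    ring_nf

/-! ### Independence of the past and the current slot -/

instance (n : ℕ) : IsProbabilityMeasure (coinMeasure n) := by
  unfold coinMeasure; infer_instance

/-- The information in the coins of the slots before slot `t`. -/
abbrev past (n t : ℕ) : MeasurableSpace (Coins n) :=
  ⨆ i ∈ Set.Iio t, MeasurableSpace.comap (fun ω : Coins n => ω i) inferInstance

lemma past_le (n t : ℕ) : past n t ≤ MeasurableSpace.pi :=
  iSup₂_le fun i _ => (measurable_pi_apply i).comap_le

lemma past_mono (n : ℕ) {t t' : ℕ} (h : t ≤ t') : past n t ≤ past n t' :=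
  biSup_mono fun _ hi => lt_of_lt_of_le hi h

lemma indep_past (n t : ℕ) :
    Indep (past n t) (MeasurableSpace.comap (fun ω : Coins n => ω t) inferInstance)
      (coinMeasure n) := by
  have h : iIndepFun (fun i (ω : Coins n) => ω i) (coinMeasure n) :=
    iIndepFun_infinitePi (P := fun _ : ℕ => Measure.pi fun _ : Fin n =>
      (volume : Measure unitInterval)) (X := fun _ ω => ω) (fun _ => measurable_id)
  have := indep_iSup_of_disjoint (fun i => (measurable_pi_apply i).comap_le) h
    (S := Set.Iio t) (T := {t}) (by simp)
  simpa [past] using this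

/-- In bounded time only finitely many situations are possible, so the uncountable type of local
states needs no measurable structure. -/
lemma traj_finite (n t : ℕ) : (Set.range fun ω : Coins n => traj P ω t).Finite := by
  classical
  induction t with
  | zero => exact (Set.finite_singleton (P.start, Finset.univ)).subset (by rintro _ ⟨ω, rfl⟩; rfl)
  | succ t ih =>
    have h : ((fun q : (P.State × Finset (Fin n)) × Finset (Fin n) =>
        ((P.next q.1.1 (feedback q.2), if feedback q.2 = .success then q.1.2 \ q.2 else q.1.2) :
          P.State × Finset (Fin n))) ''
        ((Set.range fun ω : Coins n => traj P ω t) ×ˢ Set.univ)).Finite :=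
      (ih.prod Set.finite_univ).image _
    refine h.subset ?_
    rintro _ ⟨ω, rfl⟩
    exact ⟨(traj P ω t, sendSet P (traj P ω t) (ω t)), ⟨⟨ω, rfl⟩, trivial⟩, rfl⟩

lemma traj_measurable (n t : ℕ) (B : Set (P.State × Finset (Fin n))) :
    MeasurableSet[past n t] {ω : Coins n | traj P ω t ∈ B} := by
  classical
  induction t generalizing B with
  | zero =>
    by_cases h : ((P.start, Finset.univ) : P.State × Finset (Fin n)) ∈ B
    · have : {ω : Coins n | traj P ω 0 ∈ B} = Set.univ := by ext; simpa [traj] using h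
      rw [this]; exact @MeasurableSet.univ _ (past n 0)
    · have : {ω : Coins n | traj P ω 0 ∈ B} = ∅ := by ext; simpa [traj] using h
      rw [this]; exact @MeasurableSet.empty _ (past n 0)
  | succ t ih =>
    have : {ω : Coins n | traj P ω (t + 1) ∈ B} = ⋃ z ∈ Set.range fun ω : Coins n => traj P ω t,
        ({ω | traj P ω t ∈ ({z} : Set _)} ∩ (fun ω : Coins n => ω t) ⁻¹' {u | advance P z u ∈ B}) := by
      ext ω
      simp only [Set.mem_ofPred_eq, traj, Set.mem_range, Set.mem_singleton_iff, Set.iUnion_exists,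
        Set.iUnion_iUnion_eq', Set.mem_iUnion, Set.mem_inter_iff, Set.mem_preimage]
      exact ⟨fun h => ⟨ω, rfl, h⟩, fun ⟨_, h1, h2⟩ => by rw [h1]; exact h2⟩
    rw [this]
    refine MeasurableSet.biUnion (traj_finite P n t).countable fun z _ => ?_
    refine MeasurableSet.inter (past_mono n (Nat.le_succ t) _ (ih _)) ?_
    have hB : MeasurableSet {u | advance P z u ∈ B} :=
      measurableSet_sendSet P z {S | (P.next z.1 (feedback S),
        if feedback S = .success then z.2 \ S else z.2) ∈ B}
    have hle : MeasurableSpace.comap (fun ω : Coins n => ω t) inferInstance ≤ past n (t + 1) :=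
      le_biSup (fun i => MeasurableSpace.comap (fun ω : Coins n => ω i) inferInstance)
        (Nat.lt_succ_self t)
    exact hle _ ⟨_, hB, rfl⟩

lemma traj_measurable' (n t : ℕ) (B : Set (P.State × Finset (Fin n))) :
    MeasurableSet {ω : Coins n | traj P ω t ∈ B} := past_le n t _ (traj_measurable P n t B)

lemma slotFeedback_measurable (n t : ℕ) (f : Feedback) :
    MeasurableSet {ω : Coins n | slotFeedback P ω t = f} := by
  have : {ω : Coins n | slotFeedback P ω t = f} = ⋃ z ∈ Set.range fun ω : Coins n => traj P ω t,
      ({ω | traj P ω t ∈ ({z} : Set _)} ∩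
        (fun ω : Coins n => ω t) ⁻¹' {u | feedback (sendSet P z u) = f}) := by
    ext ω
    simp only [Set.mem_ofPred_eq, slotFeedback_eq, Set.mem_range, Set.mem_singleton_iff,
      Set.iUnion_exists, Set.iUnion_iUnion_eq', Set.mem_iUnion, Set.mem_inter_iff,
      Set.mem_preimage]
    exact ⟨fun h => ⟨ω, rfl, h⟩, fun ⟨_, h1, h2⟩ => by rw [h1]; exact h2⟩
  rw [this]
  refine MeasurableSet.biUnion (traj_finite P n t).countable fun z _ => ?_
  exact (traj_measurable' P n t _).inter
    ((measurable_pi_apply t) (measurableSet_sendSet P z {S | feedback S = f}))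

lemma measure_traj_inter (n t : ℕ) (z : P.State × Finset (Fin n)) (f : Feedback) :
    coinMeasure n ({ω | traj P ω t = z} ∩ {ω | slotFeedback P ω t = f}) =
      coinMeasure n {ω | traj P ω t = z} * ENNReal.ofReal (fbProb (P.prob z.1) z.2.card f) := by
  have hB : MeasurableSet {u | feedback (sendSet P z u) = f} :=
    measurableSet_sendSet P z {S | feedback S = f}
  have h1 : {ω : Coins n | traj P ω t = z} ∩ {ω | slotFeedback P ω t = f} =
      {ω | traj P ω t ∈ ({z} : Set _)} ∩
        (fun ω : Coins n => ω t) ⁻¹' {u | feedback (sendSet P z u) = f} := by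
    ext ω
    simp only [Set.mem_inter_iff, Set.mem_ofPred_eq, slotFeedback_eq, Set.mem_singleton_iff,
      Set.mem_preimage]
    constructor
    · rintro ⟨rfl, h⟩; exact ⟨rfl, h⟩
    · rintro ⟨rfl, h⟩; exact ⟨rfl, h⟩
  rw [h1, (Indep_iff _ _ _).1 (indep_past n t) _ _ (traj_measurable P n t _) ⟨_, hB, rfl⟩,
    ← measure_feedback P z f]
  congr 1
  exact (measurePreserving_eval_infinitePi (fun _ : ℕ => Measure.pi fun _ : Fin n =>
    (volume : Measure unitInterval)) t).measure_preimage hB.nullMeasurableSet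

lemma measurable_comp_traj (n t : ℕ) (G : P.State × Finset (Fin n) → ℝ≥0∞) :
    Measurable fun ω : Coins n => G (traj P ω t) :=
  fun B _ => traj_measurable' P n t (G ⁻¹' B)

/-- Integrating out the feedback of slot `t`, given the past. -/
lemma lintegral_slot (n t : ℕ) (H : P.State × Finset (Fin n) → Feedback → ℝ≥0∞) :
    ∫⁻ ω, H (traj P ω t) (slotFeedback P ω t) ∂coinMeasure n =
      ∫⁻ ω, (ENNReal.ofReal (emptyProb (P.prob (traj P ω t).1) (traj P ω t).2.card) *
          H (traj P ω t) .empty +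
        ENNReal.ofReal (succProb (P.prob (traj P ω t).1) (traj P ω t).2.card) *
          H (traj P ω t) .success +
        ENNReal.ofReal (collProb (P.prob (traj P ω t).1) (traj P ω t).2.card) *
          H (traj P ω t) .collision) ∂coinMeasure n := by
  classical
  -- Both sides are sums over the finitely many values `z` of `traj`, and the event that `z` is taken
  -- is independent of the coins of slot `t`.
  set R := (traj_finite P n t).toFinset
  have hR : ∀ ω : Coins n, traj P ω t ∈ R := fun ω => by simp [R]
  have key : ∀ G : Coins n → P.State × Finset (Fin n) → ℝ≥0∞, ∀ ω : Coins n,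
      G ω (traj P ω t) = ∑ z ∈ R, {ω | traj P ω t = z}.indicator (fun ω => G ω z) ω := by
    intro G ω
    rw [Finset.sum_eq_single (traj P ω t)]
    · simp
    · intro z _ hz
      simp [hz.symm]
    · intro h; exact absurd (hR ω) h
  have hmz : ∀ z, MeasurableSet {ω : Coins n | traj P ω t = z} := fun z =>
    traj_measurable' P n t {z}
  have split : ∀ z (ω : Coins n), {ω | traj P ω t = z}.indicator
        (fun ω => H z (slotFeedback P ω t)) ω =
      ({ω | traj P ω t = z} ∩ {ω | slotFeedback P ω t = .empty}).indicator
        (fun _ => H z .empty) ω +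
      ({ω | traj P ω t = z} ∩ {ω | slotFeedback P ω t = .success}).indicator
        (fun _ => H z .success) ω +
      ({ω | traj P ω t = z} ∩ {ω | slotFeedback P ω t = .collision}).indicator
        (fun _ => H z .collision) ω := by
    intro z ω
    by_cases h : traj P ω t = z
    · cases hf : slotFeedback P ω t <;> simp [Set.indicator, h, hf]
    · simp [Set.indicator, h]
  have hmi : ∀ z f, MeasurableSet
      ({ω : Coins n | traj P ω t = z} ∩ {ω | slotFeedback P ω t = f}) := fun z f =>
    (hmz z).inter (slotFeedback_measurable P n t f)
  have hl : ∀ z f, ∫⁻ ω, ({ω : Coins n | traj P ω t = z} ∩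
      {ω | slotFeedback P ω t = f}).indicator (fun _ => H z f) ω ∂coinMeasure n =
      ENNReal.ofReal (fbProb (P.prob z.1) z.2.card f) * H z f *
        coinMeasure n {ω | traj P ω t = z} := by
    intro z f
    rw [lintegral_indicator_const (hmi z f), measure_traj_inter]
    ring
  rw [lintegral_congr (fun ω => key (fun ω z => H z (slotFeedback P ω t)) ω)]
  rw [lintegral_congr (fun ω => key (fun _ z =>
      (ENNReal.ofReal (emptyProb (P.prob z.1) z.2.card) * H z .empty +
        ENNReal.ofReal (succProb (P.prob z.1) z.2.card) * H z .success +
        ENNReal.ofReal (collProb (P.prob z.1) z.2.card) * H z .collision)) ω)]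
  rw [lintegral_finsetSum, lintegral_finsetSum]
  · refine Finset.sum_congr rfl fun z _ => ?_
    rw [lintegral_congr (split z), lintegral_indicator_const (hmz z),
      lintegral_add_left, lintegral_add_left, hl, hl, hl]
    · simp only [fbProb]; ring
    · exact measurable_const.indicator (hmi z _)
    · exact (measurable_const.indicator (hmi z _)).add (measurable_const.indicator (hmi z _))
  · exact fun z _ => measurable_const.indicator (hmz z)
  · intro z _
    refine (congrArg Measurable (funext (split z))).mpr ?_
    exact ((measurable_const.indicator (hmi z _)).add (measurable_const.indicator (hmi z _))).add
      (measurable_const.indicator (hmi z _))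

lemma measure_collision (n t : ℕ) :
    coinMeasure n {ω | slotFeedback P ω t = .collision} =
      ∫⁻ ω, ENNReal.ofReal (collProb (P.prob (traj P ω t).1) (traj P ω t).2.card)
        ∂coinMeasure n := by
  classical
  have h := lintegral_slot P n t (fun _ f => if f = .collision then 1 else 0)
  simp only [reduceCtorEq, if_false, if_true, mul_zero, mul_one, zero_add] at h
  rw [← h, ← lintegral_indicator_one (slotFeedback_measurable P n t _)]
  exact lintegral_congr fun ω => by simp [Set.indicator]

lemma lintegral_costToGo_succ {M : ℝ} (hM : 0 ≤ M) (n t k : ℕ) :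
    ∫⁻ ω, ENNReal.ofReal (costToGo P M (k + 1) (traj P ω t).1 (traj P ω t).2.card)
        ∂coinMeasure n =
      coinMeasure n {ω | slotFeedback P ω t = .collision} +
        ∫⁻ ω, ENNReal.ofReal (costToGo P M k (traj P ω (t + 1)).1 (traj P ω (t + 1)).2.card)
          ∂coinMeasure n := by
  classical
  -- By `card_advance`, the situation after slot `t` depends only on the one before and the feedback.
  have h1 : ∀ ω : Coins n, ENNReal.ofReal
      (costToGo P M k (traj P ω (t + 1)).1 (traj P ω (t + 1)).2.card) =
      (fun (z : P.State × Finset (Fin n)) f =>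
        ENNReal.ofReal (costToGo P M k (P.next z.1 f) (remaining z.2.card f)))
        (traj P ω t) (slotFeedback P ω t) := by
    intro ω
    simp only [traj, card_advance, slotFeedback_eq]
    rfl
  rw [lintegral_congr h1, lintegral_slot P n t (fun z f =>
      ENNReal.ofReal (costToGo P M k (P.next z.1 f) (remaining z.2.card f))),
    measure_collision, ← lintegral_add_left]
  · refine lintegral_congr fun ω => ?_
    have hp0 := P.prob_nonneg (traj P ω t).1
    have hp1 := P.prob_le_one (traj P ω t).1
    have a := fun m => emptyProb_nonneg hp1 m
    have b := fun m => succProb_nonneg hp0 hp1 m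
    have c := fun m => collProb_nonneg hp0 hp1 m
    have w := fun s m => costToGo_nonneg (P := P) hM k s m
    rw [← ENNReal.ofReal_mul (a _), ← ENNReal.ofReal_mul (b _), ← ENNReal.ofReal_mul (c _),
      ← ENNReal.ofReal_add (mul_nonneg (a _) (w _ _)) (mul_nonneg (b _) (w _ _)),
      ← ENNReal.ofReal_add (add_nonneg (mul_nonneg (a _) (w _ _)) (mul_nonneg (b _) (w _ _)))
        (mul_nonneg (c _) (w _ _)), ← ENNReal.ofReal_add (c _) (add_nonneg (add_nonneg
        (mul_nonneg (a _) (w _ _)) (mul_nonneg (b _) (w _ _))) (mul_nonneg (c _) (w _ _)))]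
    rfl
  · exact measurable_comp_traj P n t fun z =>
      ENNReal.ofReal (collProb (P.prob z.1) z.2.card)

/-- The value iteration `costToGo` computes the expected number of collisions in the first `N`
slots plus the penalty `M` for every execution that is not finished after them. -/
lemma sum_collisions_add_penalty {M : ℝ} (hM : 0 ≤ M) (n N : ℕ) :
    ∑ t ∈ Finset.range N, coinMeasure n {ω | slotFeedback P ω t = .collision} +
      ENNReal.ofReal M * coinMeasure n {ω | (traj P ω N).2 ≠ ∅} =
    ENNReal.ofReal (costToGo P M N P.start n) := by
  have key : ∀ k t, ∑ i ∈ Finset.range t, coinMeasure n {ω | slotFeedback P ω i = .collision} +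
      ∫⁻ ω, ENNReal.ofReal (costToGo P M k (traj P ω t).1 (traj P ω t).2.card) ∂coinMeasure n =
      ENNReal.ofReal (costToGo P M (t + k) P.start n) := by
    intro k t
    induction t generalizing k with
    | zero => simp [traj]
    | succ t ih =>
      rw [Finset.sum_range_succ, add_assoc, ← lintegral_costToGo_succ P hM, ih]
      congr 2
      omega
  have h := key 0 N
  rw [add_zero] at h
  rw [← h]
  congr 1
  have hm : MeasurableSet {ω : Coins n | (traj P ω N).2 ≠ ∅} := traj_measurable' P n N {z | z.2 ≠ ∅}
  rw [← lintegral_indicator_const hm]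
  refine lintegral_congr fun ω => ?_
  by_cases h0 : (traj P ω N).2 = ∅ <;> simp [Set.indicator, costToGo, h0]

/-! ### Makespan and collision cost -/

lemma makespan_le_iff (ω : Coins n) (N : ℕ) : makespan P ω ≤ N ↔ (traj P ω N).2 = ∅ := by
  constructor
  · intro h
    by_contra hN
    have h2 : ((N + 1 : ℕ) : ℕ∞) ≤ makespan P ω := by
      refine le_iInf₂ fun t ht => ?_
      rw [config_none_iff] at ht
      have : ¬ t ≤ N := fun h => hN (traj_empty_mono P ω h ht)
      exact_mod_cast (by omega : N + 1 ≤ t)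
    have h3 : ((N + 1 : ℕ) : ℕ∞) ≤ N := h2.trans h
    have : N + 1 ≤ N := by exact_mod_cast h3
    omega
  · intro h
    exact iInf₂_le N ((config_none_iff P ω N).2 h)

lemma makespan_le_ofReal_iff (ω : Coins n) {x : ℝ} (hx : 0 ≤ x) :
    ((makespan P ω : ℕ∞) : ℝ≥0∞) ≤ ENNReal.ofReal x ↔ (traj P ω ⌊x⌋₊).2 = ∅ := by
  rw [← makespan_le_iff]
  cases h : makespan P ω with
  | top => simp
  | coe t =>
    rw [ENat.toENNReal_coe, Nat.cast_le, Nat.le_floor_iff hx, ← ENNReal.ofReal_natCast,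
      ENNReal.ofReal_le_ofReal_iff hx]

lemma collisions_subset (ω : Coins n) {N : ℕ} (h : (traj P ω N).2 = ∅) :
    {t | slotFeedback P ω t = .collision} ⊆ Set.Iio N := by
  intro t ht
  by_contra hN
  have := slotFeedback_of_empty P ω (traj_empty_mono P ω (not_lt.1 hN) h)
  simp_all

/-- If all packets have succeeded after `N` slots, only collisions in these slots count. -/
lemma collisionCost_eq (C : ℝ) (ω : Coins n) {N : ℕ} (h : (traj P ω N).2 = ∅) :
    collisionCost P C ω = ENNReal.ofReal C * ∑ t ∈ Finset.range N,
      {ω | slotFeedback P ω t = .collision}.indicator 1 ω := by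
  classical
  have h1 : {t | slotFeedback P ω t = .collision} =
      ((Finset.range N).filter fun t => slotFeedback P ω t = .collision : Finset ℕ) := by
    ext t
    have := @collisions_subset P n ω N h t
    simp only [Set.mem_ofPred_eq, Set.mem_Iio] at this
    simpa using this
  rw [collisionCost, h1, Set.encard_coe_eq_coe_finsetCard]
  simp [Set.indicator]

lemma measurableSet_finished (n N : ℕ) : MeasurableSet {ω : Coins n | (traj P ω N).2 = ∅} :=
  traj_measurable' P n N {z | z.2 = ∅}

/-- The expected collision cost on the event that all packets have succeeded after `N` slots. -/
lemma setLIntegral_collisionCost_le (C : ℝ) (n N : ℕ) :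
    ∫⁻ ω in {ω | (traj P ω N).2 = ∅}, collisionCost P C ω ∂coinMeasure n ≤
      ENNReal.ofReal C *
        ∑ t ∈ Finset.range N, coinMeasure n {ω | slotFeedback P ω t = .collision} := by
  have hm : ∀ t, Measurable ({ω : Coins n | slotFeedback P ω t = .collision}.indicator
      (1 : Coins n → ℝ≥0∞)) := fun t =>
    measurable_one.indicator (slotFeedback_measurable P n t _)
  calc ∫⁻ ω in {ω | (traj P ω N).2 = ∅}, collisionCost P C ω ∂coinMeasure n
      = ∫⁻ ω in {ω | (traj P ω N).2 = ∅}, ENNReal.ofReal C * ∑ t ∈ Finset.range N,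
          {ω | slotFeedback P ω t = .collision}.indicator 1 ω ∂coinMeasure n :=
        setLIntegral_congr_fun (measurableSet_finished P n N)
          fun ω hω => collisionCost_eq P C ω hω
    _ ≤ ∫⁻ ω, ENNReal.ofReal C * ∑ t ∈ Finset.range N,
          {ω | slotFeedback P ω t = .collision}.indicator 1 ω ∂coinMeasure n :=
        setLIntegral_le_lintegral _ _
    _ = _ := by
        rw [lintegral_const_mul _ (Finset.measurable_sum _ fun t _ => hm t),
          lintegral_finsetSum _ fun t _ => hm t]
        congr 1
        refine Finset.sum_congr rfl fun t _ => ?_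
        exact lintegral_indicator_one (slotFeedback_measurable P n t _)

/-- The trivial bound on the collision cost: every slot is a collision. -/
lemma collisionCost_le (C : ℝ) (ω : Coins n) {N : ℕ} (h : (traj P ω N).2 = ∅) :
    collisionCost P C ω ≤ ENNReal.ofReal C * N := by
  rw [collisionCost_eq P C ω h]
  gcongr
  have h1 : ∀ t ∈ Finset.range N,
      {ω | slotFeedback P ω t = .collision}.indicator (1 : Coins n → ℝ≥0∞) ω ≤ 1 := fun t _ =>
    Set.indicator_apply_le' (fun _ => le_rfl) fun _ => zero_le_one
  simpa using Finset.sum_le_sum h1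

end Trajectory

/-! ### Tail bounds from exponential supermartingales -/

/-- `Φ l s k m` is a supermartingale as long as at most `mb` packets send with probability `q`;
here `l` slots are still to come, `s` successes and `k` collisions have been counted, and `m`
packets are active. -/
def IsSuper (q : ℝ) (mb : ℕ) (Φ : ℕ → ℕ → ℕ → ℕ → ℝ) : Prop :=
  ∀ l s k m, m ≤ mb → emptyProb q m * Φ l s k m + succProb q m * Φ l (s + 1) k (m - 1) +
    collProb q m * Φ l s (k + 1) m ≤ Φ (l + 1) s k m

/-- The certificate that, if `mb` packets send with probability `q` in each of `L` slots and
terminate upon success, then with probability at most `δ` the numbers `s` of successes, `k` of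
collisions and `m` of packets that are left satisfy `Bad s k m`: a nonnegative supermartingale
that starts at `δ` or below and is at least `1` in the end if `Bad` holds. -/
def TailBound (q : ℝ) (mb L : ℕ) (δ : ℝ) (Bad : ℕ → ℕ → ℕ → Prop) : Prop :=
  ∃ Φ : ℕ → ℕ → ℕ → ℕ → ℝ, IsSuper q mb Φ ∧ (∀ l s k m, 0 ≤ Φ l s k m) ∧ Φ L 0 0 mb ≤ δ ∧
    ∀ s k m, m ≤ mb → Bad s k m → 1 ≤ Φ 0 s k m

lemma TailBound.or {q : ℝ} {mb L : ℕ} {δ₁ δ₂ : ℝ} {B₁ B₂ : ℕ → ℕ → ℕ → Prop}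
    (h₁ : TailBound q mb L δ₁ B₁) (h₂ : TailBound q mb L δ₂ B₂) :
    TailBound q mb L (δ₁ + δ₂) fun s k m => B₁ s k m ∨ B₂ s k m := by
  obtain ⟨Φ, a, b, c, e⟩ := h₁
  obtain ⟨Ψ, a', b', c', e'⟩ := h₂
  refine ⟨fun l s k m => Φ l s k m + Ψ l s k m, fun l s k m hm => ?_,
    fun l s k m => add_nonneg (b ..) (b' ..), add_le_add c c', fun s k m hm h => ?_⟩
  · have := a l s k m hm
    have := a' l s k m hm
    simp only
    linarith
  · have h1 := b 0 s k m
    have h2 := b' 0 s k m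
    rcases h with h | h
    · have := e s k m hm h
      simp only
      linarith
    · have := e' s k m hm h
      simp only
      linarith

lemma TailBound.mono {q : ℝ} {mb L : ℕ} {δ δ' : ℝ} {B B' : ℕ → ℕ → ℕ → Prop}
    (h : TailBound q mb L δ B) (hδ : δ ≤ δ') (hB : ∀ s k m, m ≤ mb → B' s k m → B s k m) :
    TailBound q mb L δ' B' := by
  obtain ⟨Φ, a, b, c, e⟩ := h
  exact ⟨Φ, a, b, c.trans hδ, fun s k m hm h => e s k m hm (hB s k m hm h)⟩

lemma tailBound_false (q : ℝ) (mb L : ℕ) : TailBound q mb L 0 fun _ _ _ => False :=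
  ⟨fun _ _ _ _ => 0, fun _ _ _ _ _ => by simp, fun _ _ _ _ => le_rfl, le_rfl,
    fun _ _ _ _ h => h.elim⟩

/-- Weights `exp α` for successes and `exp β` for collisions, whose mean in a slot is at most `ρ`
as long as at least `mlo` packets are active. -/
lemma tailBound_exp {q : ℝ} (hq0 : 0 ≤ q) (hq1 : q ≤ 1) {mb L : ℕ} {δ mlo α β u ρ : ℝ}
    (hρ0 : 0 ≤ ρ)
    (hρ : ∀ m : ℕ, m ≤ mb → mlo ≤ m →
      emptyProb q m + Real.exp α * succProb q m + Real.exp β * collProb q m ≤ ρ)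
    (hδ : Real.exp (-u) * ρ ^ L ≤ δ) :
    TailBound q mb L δ fun s k m => mlo ≤ m ∧ u ≤ α * s + β * k := by
  classical
  refine ⟨fun l s k m => if mlo ≤ m then Real.exp (α * s + β * k - u) * ρ ^ l else 0,
    fun l s k m hm => ?_, fun l s k m => ?_, ?_, fun s k m _ h => ?_⟩
  · simp only
    have hE := emptyProb_nonneg hq1 m
    have hS := succProb_nonneg hq0 hq1 m
    have hC := collProb_nonneg hq0 hq1 m
    by_cases h : mlo ≤ m
    · rw [if_pos h, if_pos h, if_pos h]
      have h1 : (if mlo ≤ ((m - 1 : ℕ) : ℝ) then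
          Real.exp (α * (s + 1 : ℕ) + β * k - u) * ρ ^ l else 0) ≤
          Real.exp α * (Real.exp (α * s + β * k - u) * ρ ^ l) := by
        have : Real.exp α * (Real.exp (α * s + β * k - u) * ρ ^ l) =
            Real.exp (α * (s + 1 : ℕ) + β * k - u) * ρ ^ l := by
          rw [← mul_assoc, ← Real.exp_add]
          push_cast
          ring_nf
        rw [this]
        split_ifs
        · exact le_rfl
        · positivity
      have h2 : Real.exp (α * s + β * (k + 1 : ℕ) - u) * ρ ^ l =
          Real.exp β * (Real.exp (α * s + β * k - u) * ρ ^ l) := by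
        rw [← mul_assoc, ← Real.exp_add]
        push_cast
        ring_nf
      rw [h2]
      have h3 := mul_le_mul_of_nonneg_left h1 hS
      have h4 := hρ m hm h
      have h5 : 0 ≤ Real.exp (α * s + β * k - u) * ρ ^ l := by positivity
      have h6 := mul_le_mul_of_nonneg_right h4 h5
      rw [pow_succ]
      linarith
    · have h' : ¬ mlo ≤ ((m - 1 : ℕ) : ℝ) := fun h1 => h (h1.trans (by
        exact_mod_cast Nat.sub_le m 1))
      simp [h, h']
  · simp only
    split_ifs <;> positivity
  · simp only
    split_ifs
    · simpa using hδ
    · exact le_trans (by positivity) hδ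
  · simp only [if_pos h.1, pow_zero, mul_one]
    exact Real.one_le_exp (by linarith [h.2])

lemma exp_one_sub_one_le : Real.exp 1 - 1 ≤ 2 := by
  have := Real.exp_one_lt_d9
  linarith

lemma exp_neg_one_le : Real.exp (-1) ≤ 1 / 2 := by
  rw [Real.exp_neg, ← one_div]
  have := Real.exp_one_gt_d9
  exact one_div_le_one_div_of_le (by norm_num) (by linarith)

lemma one_add_pow_le_exp {x : ℝ} (hx : -1 ≤ x) (L : ℕ) : (1 + x) ^ L ≤ Real.exp (x * L) := by
  rw [mul_comm, Real.exp_nat_mul]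
  exact pow_le_pow_left₀ (by linarith) (by linarith [Real.add_one_le_exp x]) L

section Tails

variable {q : ℝ} {mb L : ℕ} {δ mlo u r : ℝ}

lemma tailBound_successes_upper (hq0 : 0 ≤ q) (hq1 : q ≤ 1) (hr0 : 0 ≤ r)
    (hr : ∀ m : ℕ, m ≤ mb → succProb q m ≤ r) (hδ : Real.exp (2 * r * L - u) ≤ δ) :
    TailBound q mb L δ fun s _ _ => u ≤ s := by
  refine (tailBound_exp hq0 hq1 (mlo := 0) (α := 1) (β := 0) (u := u) (ρ := 1 + 2 * r)
    (by linarith) (fun m hm _ => ?_) ?_).mono le_rfl fun s k m _ h => ⟨by positivity, by linarith⟩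
  · have h1 := hr m hm
    have h2 := succProb_nonneg hq0 hq1 m
    have h3 := exp_one_sub_one_le
    rw [Real.exp_zero]
    unfold collProb
    nlinarith
  · refine le_trans ?_ hδ
    rw [sub_eq_neg_add, Real.exp_add]
    exact mul_le_mul_of_nonneg_left (one_add_pow_le_exp (by linarith) L) (Real.exp_nonneg _)

lemma tailBound_collisions_upper (hq0 : 0 ≤ q) (hq1 : q ≤ 1) (hr0 : 0 ≤ r)
    (hr : ∀ m : ℕ, m ≤ mb → collProb q m ≤ r) (hδ : Real.exp (2 * r * L - u) ≤ δ) :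
    TailBound q mb L δ fun _ k _ => u ≤ k := by
  refine (tailBound_exp hq0 hq1 (mlo := 0) (α := 0) (β := 1) (u := u) (ρ := 1 + 2 * r)
    (by linarith) (fun m hm _ => ?_) ?_).mono le_rfl fun s k m _ h => ⟨by positivity, by linarith⟩
  · have h1 := hr m hm
    have h2 := collProb_nonneg hq0 hq1 m
    have h3 := exp_one_sub_one_le
    have h4 : emptyProb q m + succProb q m = 1 - collProb q m := by unfold collProb; ring
    rw [Real.exp_zero]
    nlinarith
  · refine le_trans ?_ hδ
    rw [sub_eq_neg_add, Real.exp_add]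
    exact mul_le_mul_of_nonneg_left (one_add_pow_le_exp (by linarith) L) (Real.exp_nonneg _)

lemma tailBound_successes_lower (hq0 : 0 ≤ q) (hq1 : q ≤ 1) (hr1 : r ≤ 1)
    (hr : ∀ m : ℕ, m ≤ mb → mlo ≤ m → r ≤ succProb q m) (hδ : Real.exp (u - r * L / 2) ≤ δ) :
    TailBound q mb L δ fun s _ m => mlo ≤ m ∧ s ≤ u := by
  refine (tailBound_exp hq0 hq1 (mlo := mlo) (α := -1) (β := 0) (u := -u) (ρ := 1 + -(r / 2))
    (by linarith) (fun m hm hm' => ?_) ?_).mono le_rfl fun s k m _ h => ⟨h.1, by linarith [h.2]⟩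
  · have h1 := hr m hm hm'
    have h2 := succProb_nonneg hq0 hq1 m
    have h3 := exp_neg_one_le
    rw [Real.exp_zero]
    unfold collProb
    nlinarith
  · refine le_trans ?_ hδ
    have : u - r * L / 2 = - -u + -(r / 2) * L := by ring
    rw [this, Real.exp_add]
    exact mul_le_mul_of_nonneg_left (one_add_pow_le_exp (by linarith) L) (Real.exp_nonneg _)

lemma tailBound_collisions_lower (hq0 : 0 ≤ q) (hq1 : q ≤ 1) (hr1 : r ≤ 1)
    (hr : ∀ m : ℕ, m ≤ mb → mlo ≤ m → r ≤ collProb q m) (hδ : Real.exp (u - r * L / 2) ≤ δ) :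
    TailBound q mb L δ fun _ k m => mlo ≤ m ∧ k ≤ u := by
  refine (tailBound_exp hq0 hq1 (mlo := mlo) (α := 0) (β := -1) (u := -u) (ρ := 1 + -(r / 2))
    (by linarith) (fun m hm hm' => ?_) ?_).mono le_rfl fun s k m _ h => ⟨h.1, by linarith [h.2]⟩
  · have h1 := hr m hm hm'
    have h2 := collProb_nonneg hq0 hq1 m
    have h3 := exp_neg_one_le
    have h4 : emptyProb q m + succProb q m = 1 - collProb q m := by unfold collProb; ring
    rw [Real.exp_zero]
    nlinarith
  · refine le_trans ?_ hδ
    have : u - r * L / 2 = - -u + -(r / 2) * L := by ring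
    rw [this, Real.exp_add]
    exact mul_le_mul_of_nonneg_left (one_add_pow_le_exp (by linarith) L) (Real.exp_nonneg _)

/-- If a slot without collision is very unlikely, then so is a sample in which at most half of the
slots are collisions, however short the sample is. -/
lemma tailBound_few_collisions (hq0 : 0 ≤ q) (hq1 : q ≤ 1) {η : ℝ} (hη : 0 ≤ η)
    (hr : ∀ m : ℕ, m ≤ mb → mlo ≤ m → 1 - collProb q m ≤ 2 * Real.exp (-η)) (hL : 1 ≤ L)
    (hu : u ≤ L / 2) (hδ : 3 * Real.exp (-(η / 2)) ≤ δ) (hδ1 : δ ≤ 1) :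
    TailBound q mb L δ fun _ k m => mlo ≤ m ∧ k ≤ u := by
  refine (tailBound_exp hq0 hq1 (mlo := mlo) (α := 0) (β := -η) (u := -(η * u))
    (ρ := 3 * Real.exp (-η)) (by positivity) (fun m hm hm' => ?_) ?_).mono le_rfl
      fun s k m _ h => ⟨h.1, by nlinarith [h.2]⟩
  · have h1 := hr m hm hm'
    have h2 := collProb_nonneg hq0 hq1 m
    have h2' := collProb_le_one hq0 hq1 m
    have h4 : emptyProb q m + succProb q m = 1 - collProb q m := by unfold collProb; ring
    have h5 := Real.exp_pos (-η)
    rw [Real.exp_zero]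
    nlinarith
  · have h1 : Real.exp (- -(η * u)) ≤ Real.exp (η / 2) ^ L := by
      rw [← Real.exp_nat_mul]
      exact Real.exp_le_exp.2 (by nlinarith)
    have h2 : Real.exp (η / 2) * (3 * Real.exp (-η)) = 3 * Real.exp (-(η / 2)) := by
      rw [mul_left_comm, ← Real.exp_add]
      ring_nf
    calc Real.exp (- -(η * u)) * (3 * Real.exp (-η)) ^ L
        ≤ Real.exp (η / 2) ^ L * (3 * Real.exp (-η)) ^ L :=
          mul_le_mul_of_nonneg_right h1 (by positivity)
      _ = (3 * Real.exp (-(η / 2))) ^ L := by rw [← mul_pow, h2]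
      _ ≤ (3 * Real.exp (-(η / 2))) ^ 1 :=
          pow_le_pow_of_le_one (by positivity) (hδ.trans hδ1) hL
      _ ≤ δ := by simpa using hδ

/-- Upper tail for the number of packets that terminate. -/
lemma tailBound_loss (hq0 : 0 ≤ q) (hq1 : q ≤ 1) (hr0 : 0 ≤ r)
    (hr : ∀ m : ℕ, m ≤ mb → succProb q m ≤ r) (hδ : Real.exp (2 * r * L - u) ≤ δ) :
    TailBound q mb L δ fun _ _ m => m + u ≤ mb := by
  refine ⟨fun l _ _ m => Real.exp (mb - m - u) * (1 + 2 * r) ^ l, fun l s k m hm => ?_,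
    fun l s k m => by positivity, ?_, fun s k m _ h => ?_⟩
  · simp only
    have hS0 := succProb_nonneg hq0 hq1 m
    have h1 := hr m hm
    have h3 := exp_one_sub_one_le
    have h4 : succProb q m * (Real.exp (mb - (m - 1 : ℕ) - u) * (1 + 2 * r) ^ l) =
        succProb q m * (Real.exp 1 * (Real.exp (mb - m - u) * (1 + 2 * r) ^ l)) := by
      rcases Nat.eq_zero_or_pos m with rfl | hm0
      · simp [succProb]
      · rw [← mul_assoc (Real.exp 1), ← Real.exp_add, Nat.cast_sub hm0]
        push_cast
        ring_nf
    rw [h4, pow_succ]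
    have h5 : 0 ≤ Real.exp (mb - m - u) * (1 + 2 * r) ^ l := by positivity
    have h6 : emptyProb q m + Real.exp 1 * succProb q m + collProb q m ≤ 1 + 2 * r := by
      unfold collProb
      nlinarith
    have h7 := mul_le_mul_of_nonneg_right h6 h5
    linarith
  · refine le_trans ?_ hδ
    have : 2 * r * L - u = ((mb : ℝ) - mb - u) + 2 * r * L := by ring
    rw [this, Real.exp_add]
    exact mul_le_mul_of_nonneg_left (one_add_pow_le_exp (by linarith) L) (Real.exp_nonneg _)
  · simp only [pow_zero, mul_one]
    exact Real.one_le_exp (by linarith)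

/-- If every packet succeeds in a slot with probability at least `r`, then after `L` slots some
packet is left with probability at most `mb * (1 - r) ^ L`. -/
lemma tailBound_left (hr1 : r ≤ 1)
    (hr : ∀ m : ℕ, m ≤ mb → m * r ≤ succProb q m) (hδ : mb * (1 - r) ^ L ≤ δ) :
    TailBound q mb L δ fun _ _ m => m ≠ 0 := by
  have hr1' : 0 ≤ 1 - r := by linarith
  refine ⟨fun l _ _ m => m * (1 - r) ^ l, fun l s k m hm => ?_,
    fun l s k m => by positivity, hδ, fun s k m _ h => ?_⟩
  · simp only
    have h1 := hr m hm
    have h4 : succProb q m * (((m - 1 : ℕ) : ℝ) * (1 - r) ^ l) =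
        succProb q m * ((m - 1) * (1 - r) ^ l) := by
      rcases Nat.eq_zero_or_pos m with rfl | hm0
      · simp [succProb]
      · rw [Nat.cast_sub hm0, Nat.cast_one]
    rw [h4, pow_succ]
    have h5 : 0 ≤ (1 - r) ^ l := by positivity
    have h6 : emptyProb q m * m + succProb q m * (m - 1) + collProb q m * m ≤ m * (1 - r) := by
      unfold collProb
      nlinarith
    have h7 := mul_le_mul_of_nonneg_right h6 h5
    linarith
  · simp only [pow_zero, mul_one]
    exact_mod_cast Nat.one_le_iff_ne_zero.2 h

/-- If every packet succeeds in a slot with probability at least `r`, then the number of packets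
left after `L` slots is dominated by a binomial one; `2 ^ m` as a potential gives this bound for the
probability that more than `u` packets are left. -/
lemma tailBound_many_left (hq0 : 0 ≤ q) (hq1 : q ≤ 1) (hr0 : 0 ≤ r) (hr1 : r ≤ 1)
    (hr : ∀ m : ℕ, m ≤ mb → m * r ≤ succProb q m)
    (hδ : Real.exp (-(u * Real.log 2)) * (1 + (1 - r) ^ L) ^ mb ≤ δ) :
    TailBound q mb L δ fun _ _ m => u ≤ m := by
  have hr1' : 0 ≤ 1 - r := by linarith
  refine ⟨fun l _ _ m => Real.exp (-(u * Real.log 2)) * (1 + (1 - r) ^ l) ^ m,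
    fun l s k m hm => ?_, fun l s k m => by positivity, hδ, fun s k m _ h => ?_⟩
  · simp only
    have h1 := hr m hm
    have hS0 := succProb_nonneg hq0 hq1 m
    set a := 1 + (1 - r) ^ l with ha
    have hx0 : 0 ≤ (1 - r) ^ l := by positivity
    have ha1 : 1 ≤ a := by linarith
    have hb : 1 + (1 - r) ^ (l + 1) = a * (1 - (1 - a⁻¹) * r) := by
      have : a ≠ 0 := by linarith
      rw [pow_succ]
      field_simp
      rw [ha]
      ring
    have hai : a⁻¹ ≤ 1 := inv_le_one_of_one_le₀ ha1
    have hai0 : 0 < a⁻¹ := inv_pos.2 (by linarith)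
    -- Bernoulli's inequality compares one slot with the removal of every packet independently.
    have hbern := one_sub_mul_le_pow (p := (1 - a⁻¹) * r) (by nlinarith) m
    have h4 : succProb q m * (Real.exp (-(u * Real.log 2)) * a ^ (m - 1)) =
        succProb q m * (Real.exp (-(u * Real.log 2)) * (a ^ m * a⁻¹)) := by
      rcases Nat.eq_zero_or_pos m with rfl | hm0
      · simp [succProb]
      · obtain ⟨j, rfl⟩ : ∃ j, m = j + 1 := ⟨m - 1, by omega⟩
        rw [Nat.add_sub_cancel, pow_succ, mul_assoc, mul_inv_cancel₀ (by linarith), mul_one]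
    rw [h4, hb, mul_pow]
    have h6 : emptyProb q m + succProb q m * a⁻¹ + collProb q m ≤ (1 - (1 - a⁻¹) * r) ^ m := by
      refine le_trans ?_ hbern
      unfold collProb
      nlinarith
    have h5 : 0 ≤ Real.exp (-(u * Real.log 2)) * a ^ m := by positivity
    have h7 := mul_le_mul_of_nonneg_right h6 h5
    linarith
  · simp only [pow_zero]
    rw [one_add_one_eq_two, ← Real.rpow_natCast, Real.rpow_def_of_pos two_pos, ← Real.exp_add]
    exact Real.one_le_exp (by nlinarith [Real.log_pos one_lt_two])

end Tails

/-! ### Cost-to-go over a block of slots with constant sending probability -/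

/-- A block of `L` slots with sending probability `q` that ends in state `σ 0 s k` if it had `s`
successes and `k` collisions. If the outcome is `Bad` with probability at most `δ`, the cost-to-go is
at most the expected number of collisions in the block, plus the cost-to-go `V` after an outcome that
is not bad, plus `δ` times the largest cost-to-go. -/
lemma costToGo_block {P : Protocol} {M : ℝ} (hM : 0 ≤ M) {q κ V Mb δ : ℝ} {mb k₀ L : ℕ}
    {Bad : ℕ → ℕ → ℕ → Prop} (σ : ℕ → ℕ → ℕ → P.State)
    (hq0 : 0 ≤ q) (hq1 : q ≤ 1) (hσ : ∀ l s k, P.sendProb (σ (l + 1) s k) = q)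
    (hE : ∀ l s k, P.next (σ (l + 1) s k) .empty = σ l s k)
    (hS : ∀ l s k, P.next (σ (l + 1) s k) .success = σ l (s + 1) k)
    (hC : ∀ l s k, P.next (σ (l + 1) s k) .collision = σ l s (k + 1))
    (hκ : ∀ m ≤ mb, collProb q m ≤ κ)
    (hT : TailBound q mb L δ Bad) (hV : 0 ≤ V) (hMb : ∀ s m, costToGo P M k₀ s m ≤ Mb)
    (hend : ∀ s k m, m ≤ mb → ¬ Bad s k m → costToGo P M k₀ (σ 0 s k) m ≤ V) :
    costToGo P M (k₀ + L) (σ L 0 0) mb ≤ L * κ + V + Mb * δ := by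
  obtain ⟨Φ, hΦ, hΦ0, hΦL, hΦB⟩ := hT
  have hMb0 : 0 ≤ Mb := (costToGo_nonneg hM k₀ P.start 0).trans (hMb _ _)
  have key : ∀ l s k m, m ≤ mb →
      costToGo P M (k₀ + l) (σ l s k) m ≤ l * κ + V + Mb * Φ l s k m := by
    intro l
    induction l with
    | zero =>
      intro s k m hm
      rw [add_zero, Nat.cast_zero, zero_mul, zero_add]
      by_cases hB : Bad s k m
      · have := hΦB s k m hm hB
        nlinarith [hMb (σ 0 s k) m]
      · have := hΦ0 0 s k m
        nlinarith [hend s k m hm hB]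
    | succ l ih =>
      intro s k m hm
      have hp : P.prob (σ (l + 1) s k) = q := by
        rw [P.prob_of_mem (by rw [hσ]; exact hq0) (by rw [hσ]; exact hq1), hσ]
      rw [← add_assoc, costToGo, hp]
      have h1 := fbMean_mono hq0 hq1 m
        (F := fun f => costToGo P M (k₀ + l) (P.next (σ (l + 1) s k) f) (remaining m f))
        (G := fun f => (l * κ + V) + Mb * (match f with
          | .empty => Φ l s k m
          | .success => Φ l (s + 1) k (m - 1)
          | .collision => Φ l s (k + 1) m))
        (by simpa only [hE, remaining] using ih s k m hm)
        (fun _ => by simpa only [hS, remaining] using ih (s + 1) k (m - 1) (by omega))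
        (by simpa only [hC, remaining] using ih s (k + 1) m hm)
      have h2 := mul_le_mul_of_nonneg_left (hΦ l s k m hm) hMb0
      rw [fbMean_add, fbMean_const] at h1
      simp only [fbMean] at h1 h2 ⊢
      have h3 := hκ m hm
      push_cast
      linarith
  have h := key L 0 0 mb le_rfl
  have := mul_le_mul_of_nonneg_left hΦL hMb0
  linarith

/-! ### RunDown -/

lemma le_succProb_of_mul_le {p : ℝ} (h0 : 0 ≤ p) (h1 : p ≤ 1) {m : ℕ} (hm : m * p ≤ 1 / 2) :
    m * (p / 2) ≤ succProb p m := by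
  have h2 := one_sub_mul_le_pow h1 (m - 1)
  have h3 : ((m - 1 : ℕ) : ℝ) * p ≤ m * p :=
    mul_le_mul_of_nonneg_right (by exact_mod_cast Nat.sub_le m 1) h0
  unfold succProb
  exact mul_le_mul_of_nonneg_left (by nlinarith) (Nat.cast_nonneg _)

/-- The cost-to-go of Collision-Aversion Backoff. -/
noncomputable abbrev cabCost (C c d M : ℝ) (k : ℕ) (s : CAB.State) (m : ℕ) : ℝ :=
  costToGo (collisionAversionBackoff C c d) M k s m

section RunDown

variable {C c d M Mb : ℝ}

/-- The final windows of RunDown. -/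
lemma finish_le (hM : 0 ≤ M) {w₀ w : ℝ} {n m F k₀ : ℕ} (hw : 2 ≤ w₀) (hn : 4 * n ≤ w₀)
    (hm : m ≤ n) (hMb : ∀ s m, cabCost C c d M k₀ s m ≤ Mb) (hF : 1 ≤ F) :
    cabCost C c d M (k₀ + F) (.finish w₀ w F) m ≤
      F * (2 * n / w₀) ^ 2 + Mb * (n * Real.exp (-(F / w₀))) := by
  have hw0 : 0 < w₀ := by linarith
  have hq1 : 2 / w₀ ≤ 1 := (div_le_one hw0).2 hw
  have hq0 : 0 ≤ 2 / w₀ := by positivity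
  have hmn : (m : ℝ) ≤ n := by exact_mod_cast hm
  have hsmall : ∀ m' : ℕ, m' ≤ m → (m' : ℝ) * (2 / w₀) ≤ 1 / 2 := by
    intro m' hm'
    have : (m' : ℝ) ≤ m := by exact_mod_cast hm'
    rw [mul_div_assoc', div_le_div_iff₀ hw0 two_pos]
    linarith
  have hT : TailBound (2 / w₀) m F (n * Real.exp (-(F / w₀))) fun _ _ m => m ≠ 0 := by
    have h1 : (1 - 1 / w₀) ^ F ≤ Real.exp (-(F / w₀)) := by
      have := one_add_pow_le_exp (x := -(1 / w₀))
        (by rw [neg_le_neg_iff, div_le_one hw0]; linarith) F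
      calc _ = (1 + -(1 / w₀)) ^ F := by ring_nf
        _ ≤ _ := this
        _ = _ := by ring_nf
    refine tailBound_left (r := 1 / w₀) (by rw [div_le_one hw0]; linarith) (fun m' hm' => ?_) ?_
    · have := le_succProb_of_mul_le hq0 hq1 (hsmall m' hm')
      calc (m' : ℝ) * (1 / w₀) = m' * (2 / w₀ / 2) := by ring
        _ ≤ _ := this
    · have : 0 ≤ 1 - 1 / w₀ := by rw [sub_nonneg, div_le_one hw0]; linarith
      exact mul_le_mul hmn h1 (by positivity) (by positivity)
  have := costToGo_block (P := collisionAversionBackoff C c d) hM (V := 0) (Mb := Mb) (k₀ := k₀)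
    (κ := (2 * n / w₀) ^ 2)
    (fun l _ _ => match l with
      | 0 => CAB.beginSample C d w
      | l + 1 => CAB.State.finish w₀ w (l + 1)) hq0 hq1 (fun _ _ _ => rfl)
    (fun l _ _ => by cases l <;> simp [collisionAversionBackoff, CAB.next])
    (fun l _ _ => by cases l <;> simp [collisionAversionBackoff, CAB.next])
    (fun l _ _ => by cases l <;> simp [collisionAversionBackoff, CAB.next])
    (fun m' hm' => (collProb_le_sq hq0 hq1 m').trans (by
      have : (m' : ℝ) ≤ n := by exact_mod_cast hm'.trans hm
      refine pow_le_pow_left₀ (by positivity) ?_ 2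
      calc (m' : ℝ) * (2 / w₀) ≤ n * (2 / w₀) := mul_le_mul_of_nonneg_right this hq0
        _ = 2 * n / w₀ := by ring)) hT le_rfl hMb
    (fun s k m' _ h => by
      rw [not_not.1 h]
      exact (costToGo_zero_packets _ _).le)
  obtain ⟨F', rfl⟩ : ∃ F', F = F' + 1 := ⟨F - 1, by omega⟩
  simpa using this

/-- One window of the while-loop, given a bound for the probability of a bad outcome. -/
lemma run_le (hM : 0 ≤ M) {w₀ w V δ : ℝ} {m k₀ : ℕ} {Bad : ℕ → ℕ → ℕ → Prop} (hw : 2 ≤ w)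
    (hMb : ∀ s m, cabCost C c d M k₀ s m ≤ Mb) (hV : 0 ≤ V)
    (hT : TailBound (2 / w) m ⌈w⌉₊ δ Bad)
    (hend : ∀ s k m', m' ≤ m → ¬ Bad s k m' →
      cabCost C c d M k₀ (CAB.beginRun C c w₀ (w / 2)) m' ≤ V) :
    cabCost C c d M (k₀ + ⌈w⌉₊) (.run w₀ w ⌈w⌉₊) m ≤ 8 * m ^ 2 / w + V + Mb * δ := by
  have hw0 : 0 < w := by linarith
  have hq1 : 2 / w ≤ 1 := (div_le_one hw0).2 hw
  have hq0 : 0 ≤ 2 / w := by positivity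
  have hceil : (⌈w⌉₊ : ℝ) ≤ 2 * w := by linarith [Nat.ceil_lt_add_one hw0.le]
  have := costToGo_block (P := collisionAversionBackoff C c d) hM (V := V) (Mb := Mb) (k₀ := k₀)
    (κ := (m * (2 / w)) ^ 2)
    (fun l _ _ => match l with
      | 0 => CAB.beginRun C c w₀ (w / 2)
      | l + 1 => CAB.State.run w₀ w (l + 1)) hq0 hq1 (fun _ _ _ => rfl)
    (fun l _ _ => by cases l <;> simp [collisionAversionBackoff, CAB.next])
    (fun l _ _ => by cases l <;> simp [collisionAversionBackoff, CAB.next])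
    (fun l _ _ => by cases l <;> simp [collisionAversionBackoff, CAB.next])
    (fun m' hm' => (collProb_le_sq hq0 hq1 m').trans (by
      have : (m' : ℝ) ≤ m := by exact_mod_cast hm'
      exact pow_le_pow_left₀ (by positivity) (mul_le_mul_of_nonneg_right this hq0) 2)) hT hV hMb
    (fun s k m' hm' h => hend s k m' hm' h)
  obtain ⟨F', hF'⟩ : ∃ F', ⌈w⌉₊ = F' + 1 := ⟨⌈w⌉₊ - 1, by
    have := Nat.ceil_pos.2 hw0; omega⟩
  have h2 : (⌈w⌉₊ : ℝ) * (m * (2 / w)) ^ 2 ≤ 8 * m ^ 2 / w := by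
    calc (⌈w⌉₊ : ℝ) * (m * (2 / w)) ^ 2 ≤ 2 * w * (m * (2 / w)) ^ 2 :=
          mul_le_mul_of_nonneg_right hceil (by positivity)
      _ = 8 * m ^ 2 / w := by field_simp; ring
  rw [hF'] at this h2 ⊢
  simp only at this
  linarith

/-- In one window, the packets drop to half of the bound `x`, unless `x` is small. -/
lemma tailBound_window {w x : ℝ} {m : ℕ} (hw : 2 ≤ w) (hx : x ≤ w / 4) (hm : m ≤ x) :
    TailBound (2 / w) m ⌈w⌉₊ (Real.exp (-(x / 50))) fun _ _ m => x / 2 ≤ m := by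
  have hw0 : 0 < w := by linarith
  have hq1 : 2 / w ≤ 1 := (div_le_one hw0).2 hw
  have hq0 : 0 ≤ 2 / w := by positivity
  have hr1 : 1 / w ≤ 1 := by rw [div_le_one hw0]; linarith
  refine tailBound_many_left (r := 1 / w) hq0 hq1 (by positivity) hr1 (fun m' hm' => ?_) ?_
  · have h0 : (m' : ℝ) ≤ m := by exact_mod_cast hm'
    have h1 : (m' : ℝ) * (2 / w) ≤ 1 / 2 := by
      rw [mul_div_assoc', div_le_div_iff₀ hw0 two_pos]
      linarith
    have := le_succProb_of_mul_le hq0 hq1 h1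
    calc (m' : ℝ) * (1 / w) = m' * (2 / w / 2) := by ring
      _ ≤ _ := this
  · have h1 : (1 - 1 / w) ^ ⌈w⌉₊ ≤ Real.exp (-1) := by
      have := one_add_pow_le_exp (x := -(1 / w)) (by linarith) ⌈w⌉₊
      calc (1 - 1 / w) ^ ⌈w⌉₊ = (1 + -(1 / w)) ^ ⌈w⌉₊ := by ring_nf
        _ ≤ _ := this
        _ ≤ _ := Real.exp_le_exp.2 (by
          have := mul_le_mul_of_nonneg_left (Nat.le_ceil w) (one_div_pos.2 hw0).le
          rw [one_div_mul_cancel hw0.ne'] at this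
          linarith)
    -- `1 + 1/e < exp 0.32 < √2`: a window leaves a packet with probability at most `1/e`.
    have h2 : 1 + Real.exp (-1) ≤ Real.exp (32 / 100) := by
      have a := Real.exp_neg_one_lt_d9
      have b := Real.quadratic_le_exp_of_nonneg (x := 32 / 100) (by norm_num)
      linarith
    have h3 : (1 + (1 - 1 / w) ^ ⌈w⌉₊) ^ m ≤ Real.exp (32 / 100 * x) := by
      have h0 : 0 ≤ (1 - 1 / w) ^ ⌈w⌉₊ := pow_nonneg (by linarith) _
      calc (1 + (1 - 1 / w) ^ ⌈w⌉₊) ^ m ≤ Real.exp (32 / 100) ^ m :=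
            pow_le_pow_left₀ (by linarith) (by linarith) m
        _ = Real.exp (m * (32 / 100)) := by rw [Real.exp_nat_mul]
        _ ≤ _ := Real.exp_le_exp.2 (by linarith)
    calc _ ≤ Real.exp (-(x / 2 * Real.log 2)) * Real.exp (32 / 100 * x) :=
          mul_le_mul_of_nonneg_left h3 (Real.exp_nonneg _)
      _ ≤ _ := by
          rw [← Real.exp_add]
          have := Real.log_two_gt_d9
          have : (0 : ℝ) ≤ x := (Nat.cast_nonneg m).trans hm
          exact Real.exp_le_exp.2 (by nlinarith)

/-- The while-loop of RunDown. The active packets are kept below `w / (4 √C)` until that is smaller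
than `Λ`. The number of collisions in a window of size `w` is then at most `w / C + 16 Λ² / w`, which
is summed over the geometric sequence of the windows. -/
lemma beginRun_le (hC : 1 ≤ C) (hM : 0 ≤ M) (hMb0 : 0 ≤ Mb) {w₀ Λ V₄ δ wmin : ℝ} {n F N : ℕ}
    (hwmin : wmin = 8 * √C * Real.logb 2 w₀) (hwmin8 : 8 ≤ wmin)
    (hF : F = ⌈c * Real.log w₀⌉₊ * ⌈w₀⌉₊)
    (hδ0 : 0 ≤ δ) (hδ : Real.exp (-(Λ / 50)) ≤ δ)
    (hMb : ∀ k ≤ N, ∀ s m, cabCost C c d M k s m ≤ Mb) (hV₄ : 0 ≤ V₄)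
    (hfin : ∀ k ≤ N, F ≤ k → ∀ w m, m ≤ n → cabCost C c d M k (.finish w₀ w F) m ≤ V₄)
    (j : ℕ) (w : ℝ) (m k : ℕ) (hj : w < 2 ^ j * wmin) (hw : wmin / 2 ≤ w) (hmn : m ≤ n)
    (hm : m ≤ w / (4 * √C) ∨ m ≤ Λ) (hk : 4 * w + F ≤ k) (hkN : k ≤ N) :
    cabCost C c d M k (CAB.beginRun C c w₀ w) m ≤
      (2 * w / C + 16 * Λ ^ 2 * (2 / wmin - 1 / w)) + j * (Mb * δ) + V₄ := by
  have hA : ∀ w, wmin / 2 ≤ w → 0 ≤ 2 * w / C + 16 * Λ ^ 2 * (2 / wmin - 1 / w) := by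
    intro w hw
    have h1 : 1 / w ≤ 2 / wmin := by
      rw [div_le_div_iff₀ (by linarith) (by linarith)]; linarith
    have h2 : 0 ≤ 2 * w / C := div_nonneg (by linarith) (by linarith)
    have h3 : 0 ≤ 16 * Λ ^ 2 * (2 / wmin - 1 / w) := mul_nonneg (by positivity) (by linarith)
    linarith
  have hsC : 1 ≤ √C := Real.one_le_sqrt.2 hC
  induction j generalizing w m k with
  | zero =>
    have h0 := hA w hw
    rw [pow_zero, one_mul, hwmin] at hj
    rw [CAB.beginRun, if_neg (not_le.2 hj), ← hF, Nat.cast_zero, zero_mul, add_zero]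
    have hFk : F ≤ k := by
      have : (F : ℝ) ≤ k := by linarith
      exact_mod_cast this
    have := hfin k hkN hFk w m hmn
    linarith
  | succ j ih =>
    have h0 := hA w hw
    by_cases hlt : w < wmin
    · rw [CAB.beginRun, if_neg (not_le.2 (hwmin ▸ hlt)), ← hF]
      have hFk : F ≤ k := by
        have : (F : ℝ) ≤ k := by linarith
        exact_mod_cast this
      have := hfin k hkN hFk w m hmn
      have : 0 ≤ ((j + 1 : ℕ) : ℝ) * (Mb * δ) := by positivity
      linarith
    · have hge : wmin ≤ w := not_lt.1 hlt
      have hw0 : 0 < w := by linarith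
      rw [CAB.beginRun, if_pos (hwmin ▸ hge)]
      have hceil : (⌈w⌉₊ : ℝ) ≤ 2 * w := by linarith [Nat.ceil_lt_add_one hw0.le]
      obtain ⟨k₀, rfl⟩ : ∃ k₀, k = k₀ + ⌈w⌉₊ := by
        refine ⟨k - ⌈w⌉₊, ?_⟩
        have : (⌈w⌉₊ : ℝ) ≤ k := by
          have : (0 : ℝ) ≤ F := Nat.cast_nonneg _
          linarith
        have : ⌈w⌉₊ ≤ k := by exact_mod_cast this
        omega
      push_cast at hk
      set V := (2 * (w / 2) / C + 16 * Λ ^ 2 * (2 / wmin - 1 / (w / 2))) + j * (Mb * δ) + V₄ with hV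
      have hV0 : 0 ≤ V := by
        have := hA (w / 2) (by linarith)
        have : 0 ≤ (j : ℝ) * (Mb * δ) := by positivity
        linarith
      have ih' : ∀ m' ≤ m, ((m' : ℝ) ≤ w / 2 / (4 * √C) ∨ (m' : ℝ) ≤ Λ) →
          cabCost C c d M k₀ (CAB.beginRun C c w₀ (w / 2)) m' ≤ V := fun m' hm' h =>
        ih (w / 2) m' k₀ (by rw [pow_succ] at hj; linarith) (by linarith) (hm'.trans hmn) h
          (by linarith) (by omega)
      have hmsq : 8 * (m : ℝ) ^ 2 / w ≤ w / C + 16 * Λ ^ 2 / w := by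
        have hsq : √C ^ 2 = C := Real.sq_sqrt (by linarith)
        have h1 : (m : ℝ) ^ 2 ≤ (w / (4 * √C)) ^ 2 + Λ ^ 2 := by
          rcases hm with h | h
          · have := pow_le_pow_left₀ (Nat.cast_nonneg m) h 2
            nlinarith
          · have := pow_le_pow_left₀ (Nat.cast_nonneg m) h 2
            have : 0 ≤ (w / (4 * √C)) ^ 2 := by positivity
            linarith
        have h2 : (w / (4 * √C)) ^ 2 = w ^ 2 / (16 * C) := by
          rw [div_pow, mul_pow, hsq]; norm_num
        rw [h2] at h1
        calc 8 * (m : ℝ) ^ 2 / w ≤ 8 * (w ^ 2 / (16 * C) + Λ ^ 2) / w := by gcongr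
          _ = w / C / 2 + 16 * Λ ^ 2 / w / 2 := by
              field_simp
              ring
          _ ≤ _ := by
              have : 0 ≤ w / C := by positivity
              have : 0 ≤ 16 * Λ ^ 2 / w := by positivity
              linarith
      have hMbk : ∀ s m, cabCost C c d M k₀ s m ≤ Mb := hMb k₀ (by omega)
      have hfinal : 8 * (m : ℝ) ^ 2 / w + V + Mb * δ ≤
          (2 * w / C + 16 * Λ ^ 2 * (2 / wmin - 1 / w)) + (j + 1 : ℕ) * (Mb * δ) + V₄ := by
        -- The bound `2w/C + 16Λ²(2/wmin - 1/w)` drops by `w/C + 16Λ²/w` if `w` is halved.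
        have h1 : V = w / C + 16 * Λ ^ 2 * (2 / wmin) - 16 * Λ ^ 2 / w * 2 + j * (Mb * δ) + V₄ := by
          rw [hV]; field_simp
          ring
        have h2 : 2 * w / C + 16 * Λ ^ 2 * (2 / wmin - 1 / w) =
            w / C + w / C + 16 * Λ ^ 2 * (2 / wmin) - 16 * Λ ^ 2 / w := by
          field_simp
          ring
        rw [h1, h2]
        push_cast
        linarith
      have htriv : (m : ℝ) ≤ Λ → cabCost C c d M (k₀ + ⌈w⌉₊) (.run w₀ w ⌈w⌉₊) m ≤
          8 * (m : ℝ) ^ 2 / w + V + Mb * δ := fun hmΛ => by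
        have := run_le (w₀ := w₀) hM (by linarith) hMbk hV0 (tailBound_false (2 / w) m ⌈w⌉₊)
          (fun s k m' hm' _ => ih' m' hm' (Or.inr (le_trans (by exact_mod_cast hm') hmΛ)))
        have := mul_nonneg hMb0 hδ0
        linarith
      refine le_trans ?_ hfinal
      by_cases hx : w / (4 * √C) ≤ Λ
      · exact htriv (hm.elim (fun h => h.trans hx) id)
      · rcases hm with hm | hm
        · have hx4 : w / (4 * √C) ≤ w / 4 :=
            div_le_div_of_nonneg_left hw0.le (by norm_num) (by linarith)
          have hT := tailBound_window (by linarith) hx4 hm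
          refine run_le (w₀ := w₀) hM (by linarith) hMbk hV0
            (hT.mono (le_trans (Real.exp_le_exp.2 (by linarith)) hδ) fun _ _ _ _ h => h)
            fun s k m' hm' h => ih' m' hm' (Or.inl ?_)
          rw [not_le] at h
          calc (m' : ℝ) ≤ w / (4 * √C) / 2 := h.le
            _ = _ := by ring
        · exact htriv hm

end RunDown

/-! ### Collect-Sample and Diagnosis -/

section Diagnosis

variable {C d w : ℝ} {s k : ℕ}

lemma log_div_exp_bounds {x : ℝ} (hx : 0 ≤ x) :
    x / 55 ≤ x / (20 * Real.exp 1) ∧ x / (20 * Real.exp 1) ≤ x / 54 ∧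
      x / 60 ≤ x / (8 * Real.exp 1 ^ 2) ∧ x / (8 * Real.exp 1 ^ 2) ≤ x / 59 := by
  have h1 := Real.exp_one_gt_d9
  have h2 := Real.exp_one_lt_d9
  have h0 := Real.exp_pos 1
  refine ⟨div_le_div_of_nonneg_left hx (by positivity) (by linarith),
    div_le_div_of_nonneg_left hx (by norm_num) (by linarith),
    div_le_div_of_nonneg_left hx (by positivity) (by nlinarith),
    div_le_div_of_nonneg_left hx (by norm_num) (by nlinarith)⟩

lemma diagnosis_eq_double (hx : 0 ≤ d * Real.log w)
    (h : d * Real.log w / (20 * Real.exp 1) < s ∨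
      d * √C * Real.log w / (8 * Real.exp 1 ^ 2) ≤ k) :
    CAB.diagnosis C d s k w = .double := by
  have hb := log_div_exp_bounds hx
  have hlow : 2 * d * Real.log w / 10 ^ 5 ≤ d * Real.log w / (20 * Real.exp 1) := by
    refine le_trans ?_ hb.1
    have : 2 * d * Real.log w / 10 ^ 5 = 2 * (d * Real.log w) / 10 ^ 5 := by ring
    rw [this, div_le_div_iff₀ (by norm_num) (by norm_num)]
    nlinarith
  unfold CAB.diagnosis
  split_ifs with h1 h2 h3 h3
  · rfl
  · rcases h with h | h
    · exact absurd h2 (not_le.2 h)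
    · exact absurd h h3
  · rfl
  · rfl
  · rcases h with h | h
    · exact absurd (lt_of_le_of_lt hlow h) h1
    · exact absurd h h3

lemma diagnosis_ne_halve (h : 2 * d * Real.log w / 10 ^ 5 < s) :
    CAB.diagnosis C d s k w ≠ .halve := by
  unfold CAB.diagnosis
  rw [if_pos h]
  split_ifs <;> simp

lemma diagnosis_ne_double (h : (s : ℝ) < d * Real.log w / (20 * Real.exp 1))
    (h' : (k : ℝ) < d * √C * Real.log w / (8 * Real.exp 1 ^ 2)) :
    CAB.diagnosis C d s k w ≠ .double := by
  unfold CAB.diagnosis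
  simp only [ge_iff_le, not_le.2 h', if_false, if_pos h.le]
  split_ifs <;> simp

lemma diagnosis_ne_runDown (h : (s : ℝ) < 2 * d * Real.log w / 10 ^ 5) :
    CAB.diagnosis C d s k w ≠ .runDown := by
  unfold CAB.diagnosis
  rw [if_neg (not_lt.2 h.le)]
  split_ifs <;> simp

lemma beginSample_of_one_lt (hw : 1 < w) :
    CAB.beginSample C d w = .sample w (CAB.sampleLength C d w) 0 0 := by
  have h : sInf {k : ℕ | 1 < 2 ^ k * w} = 0 := by
    rw [Nat.sInf_eq_zero]
    left
    simpa using hw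
  simp [CAB.beginSample, h]

lemma le_sampleLength : d * √C * Real.log w ≤ CAB.sampleLength C d w := Nat.le_ceil _

lemma sampleLength_le (h : 1 ≤ d * √C * Real.log w) :
    (CAB.sampleLength C d w : ℝ) ≤ 2 * (d * √C * Real.log w) := by
  have := Nat.ceil_lt_add_one (a := d * √C * Real.log w) (by linarith)
  unfold CAB.sampleLength
  linarith

end Diagnosis

lemma sqrt_le_self_of_one_le {x : ℝ} (hx : 1 ≤ x) : √x ≤ x :=
  Real.sqrt_le_iff.2 ⟨by linarith, by nlinarith⟩

/-- The probability of a slot without collision in terms of the load `y`. -/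
lemma one_sub_collProb_le {p : ℝ} (h0 : 0 ≤ p) (h1 : p ≤ 1) {m : ℕ} (hm : 1 ≤ m) :
    1 - collProb p m ≤ Real.exp (-(((m : ℝ) - 1) * p)) * (1 + ((m : ℝ) - 1) * p) := by
  have hm' : (1 : ℝ) ≤ m := by exact_mod_cast hm
  rw [one_sub_collProb hm]
  refine mul_le_mul_of_nonneg_right ?_ (by nlinarith)
  have := one_add_pow_le_exp (x := -p) (by linarith) (m - 1)
  rw [Nat.cast_sub hm, Nat.cast_one] at this
  calc (1 - p) ^ (m - 1) = (1 + -p) ^ (m - 1) := by ring_nf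
    _ ≤ _ := this
    _ = _ := by ring_nf

lemma exp_neg_mul_one_add_le {y : ℝ} : Real.exp (-y) * (1 + y) ≤ 2 * Real.exp (-(y / 2)) := by
  have h1 := Real.add_one_le_exp (y / 2)
  have h2 : Real.exp (-y) = Real.exp (-(y / 2)) * Real.exp (-(y / 2)) := by
    rw [← Real.exp_add]; ring_nf
  have h3 : Real.exp (-(y / 2)) * Real.exp (y / 2) = 1 := by
    rw [← Real.exp_add]; simp
  have h4 := Real.exp_pos (-(y / 2))
  rw [h2]
  nlinarith [mul_pos h4 h4]

lemma exp_neg_mul_one_add_le_const {y : ℝ} (hy : 44 / 100 ≤ y) :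
    Real.exp (-y) * (1 + y) ≤ 94 / 100 := by
  have h1 := Real.quadratic_le_exp_of_nonneg (x := y) (by linarith)
  have h3 : Real.exp (-y) * Real.exp y = 1 := by rw [← Real.exp_add]; simp
  have h4 := Real.exp_pos (-y)
  have h5 : 1 + y ≤ 94 / 100 * Real.exp y := by nlinarith
  nlinarith

/-- Quantitative assumptions on the number of packets `n`: every single tail bound for a sample is
at most `δ`, a sample of a window size up to `wmax` has at most `√C * ℓ` slots. -/
structure Regime (C d δ ℓ wmax : ℝ) (n : ℕ) : Prop where
  one_le_C : 1 ≤ C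
  one_le_d : 1 ≤ d
  hundred_le : 100 ≤ n
  delta_le_one : δ ≤ 1
  few : 3 * Real.exp (-(√n / 4 / 2)) ≤ δ
  tail : ∀ w : ℝ, √n ≤ w → Real.exp (-(d * Real.log w / 10 ^ 5)) ≤ δ
  loss : Real.exp (-(√n * ℓ)) ≤ δ
  length_le : ∀ w : ℝ, 1 < w → w ≤ wmax → (CAB.sampleLength C d w : ℝ) ≤ √C * ℓ

section Sample

variable {C d δ ℓ wmax : ℝ} {n : ℕ}

/-- For all window sizes that occur, `√C` times the load of the channel is at most `√n`. -/
lemma sqrt_mul_min_le {C w : ℝ} {n : ℕ} (hC : 1 ≤ C) (hn : 1 ≤ n)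
    (hw : C ≤ w ∨ n * √C ≤ w) : √C * min 1 (n / w) ≤ √n := by
  have hn' : (1 : ℝ) ≤ n := by exact_mod_cast hn
  have hsC : 1 ≤ √C := Real.one_le_sqrt.2 hC
  have hsn : 1 ≤ √(n : ℝ) := Real.one_le_sqrt.2 hn'
  have hsqC : √C * √C = C := Real.mul_self_sqrt (by linarith)
  have hsqn : √(n : ℝ) * √(n : ℝ) = n := Real.mul_self_sqrt (by linarith)
  rcases hw with hw | hw
  · rcases le_total (√C) (√n) with h | h
    · exact (mul_le_of_le_one_right (by linarith) (min_le_left _ _)).trans h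
    · have h1 : √C * min 1 (n / w) ≤ √C * (n / C) := by
        refine mul_le_mul_of_nonneg_left ((min_le_right _ _).trans ?_) (by linarith)
        exact div_le_div_of_nonneg_left (by linarith) (by linarith) hw
      refine h1.trans ?_
      rw [mul_div_assoc', div_le_iff₀ (by linarith)]
      have h2 := mul_le_mul_of_nonneg_left h (by positivity : 0 ≤ √C * √(n : ℝ))
      have e1 : √C * √(n : ℝ) * √(n : ℝ) = √C * n := by rw [mul_assoc, hsqn]
      have e2 : √C * √(n : ℝ) * √C = √(n : ℝ) * C := by rw [mul_comm (√C), mul_assoc, hsqC]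
      linarith
  · have h1 : √C * min 1 (n / w) ≤ √C * (n / (n * √C)) := by
      refine mul_le_mul_of_nonneg_left ((min_le_right _ _).trans ?_) (by linarith)
      exact div_le_div_of_nonneg_left (by linarith) (by positivity) hw
    refine h1.trans (le_trans (le_of_eq ?_) hsn)
    field_simp

lemma succProb_le_min {w : ℝ} {m : ℕ} (hw : 1 < w) (hm : m ≤ n) :
    succProb (1 / w) m ≤ min 1 (n / w) := by
  have h0 : 0 ≤ 1 / w := by positivity
  have h1 : 1 / w ≤ 1 := by rw [div_le_one (by linarith)]; exact hw.le
  refine le_min (succProb_le_one h0 h1 m) ((succProb_le_mul h0 h1 m).trans ?_)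
  have : (m : ℝ) ≤ n := by exact_mod_cast hm
  rw [mul_one_div]
  gcongr

lemma collProb_le_min {w : ℝ} {m : ℕ} (hw : 1 < w) (hm : m ≤ n) :
    collProb (1 / w) m ≤ min 1 (n / w) ^ 2 := by
  have h0 : 0 ≤ 1 / w := by positivity
  have h1 : 1 / w ≤ 1 := by rw [div_le_one (by linarith)]; exact hw.le
  have hmn : (m : ℝ) ≤ n := by exact_mod_cast hm
  rcases le_total 1 ((n : ℝ) / w) with h | h
  · rw [min_eq_left h, one_pow]
    exact collProb_le_one h0 h1 m
  · rw [min_eq_right h]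
    refine (collProb_le_sq h0 h1 m).trans (pow_le_pow_left₀ (by positivity) ?_ 2)
    rw [mul_one_div]
    gcongr

lemma one_le_mul_log_of_sqrt_le (hR : Regime C d δ ℓ wmax n) {w : ℝ} (hw : √n ≤ w) :
    1 ≤ d * Real.log w := by
  have hn : (100 : ℝ) ≤ n := by exact_mod_cast hR.hundred_le
  have h10 : 10 ≤ √(n : ℝ) := Real.le_sqrt_of_sq_le (by linarith)
  have h1 : 1 ≤ Real.log w := by
    rw [Real.le_log_iff_exp_le (by linarith)]
    linarith [Real.exp_one_lt_d9]
  nlinarith [hR.one_le_d]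

/-- Few packets are lost in a sample. -/
lemma tailBound_sample_loss (hR : Regime C d δ ℓ wmax n) {w : ℝ} {m : ℕ} (hw : 1 < w)
    (hwC : C ≤ w ∨ n * √C ≤ w) (hwmax : w ≤ wmax) (hm : m ≤ n) :
    TailBound (1 / w) m (CAB.sampleLength C d w) δ fun _ _ m' => m' + 3 * √n * ℓ ≤ m := by
  have h0 : 0 ≤ 1 / w := by positivity
  have h1 : 1 / w ≤ 1 := by rw [div_le_one (by linarith)]; exact hw.le
  have hmin : 0 ≤ min 1 ((n : ℝ) / w) := le_min zero_le_one (by positivity)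
  refine tailBound_loss h0 h1 hmin (fun m' hm' => succProb_le_min hw (hm'.trans hm)) ?_
  refine le_trans (Real.exp_le_exp.2 ?_) hR.loss
  have hn : 1 ≤ n := le_trans (by norm_num) hR.hundred_le
  have h2 := sqrt_mul_min_le hR.one_le_C hn hwC
  have h3 := hR.length_le w hw hwmax
  have hsC : 1 ≤ √C := Real.one_le_sqrt.2 hR.one_le_C
  have hℓ : 0 ≤ ℓ := by
    have : 0 ≤ √C * ℓ := (Nat.cast_nonneg _).trans h3
    exact nonneg_of_mul_nonneg_right this (by linarith)
  have h4 : min 1 ((n : ℝ) / w) * CAB.sampleLength C d w ≤ √n * ℓ := by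
    calc min 1 ((n : ℝ) / w) * CAB.sampleLength C d w ≤ min 1 ((n : ℝ) / w) * (√C * ℓ) :=
          mul_le_mul_of_nonneg_left h3 hmin
      _ = √C * min 1 ((n : ℝ) / w) * ℓ := by ring
      _ ≤ _ := mul_le_mul_of_nonneg_right h2 hℓ
  linarith

/-- A window that is too small leads to many collisions or to many successes. -/
lemma tailBound_not_double (hR : Regime C d δ ℓ wmax n) {w : ℝ} {m : ℕ} (hw : 1 < w)
    (hwX : w < 4 * (n * √C)) (hm : m ≤ n) :
    TailBound (1 / w) m (CAB.sampleLength C d w) δ fun s k m' =>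
      9 / 10 * (n : ℝ) ≤ m' ∧ CAB.diagnosis C d s k w ≠ .double := by
  have hw0 : 0 < w := by linarith
  have h0 : 0 ≤ 1 / w := by positivity
  have h1 : 1 / w ≤ 1 := by rw [div_le_one (by linarith)]; exact hw.le
  have hn : (100 : ℝ) ≤ n := by exact_mod_cast hR.hundred_le
  have h10 : 10 ≤ √(n : ℝ) := Real.le_sqrt_of_sq_le (by linarith)
  have hsqn : √(n : ℝ) * √(n : ℝ) = n := Real.mul_self_sqrt (by linarith)
  have hsC : 1 ≤ √C := Real.one_le_sqrt.2 hR.one_le_C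
  have hd := hR.one_le_d
  have hlog : 0 < Real.log w := Real.log_pos hw
  have hx : 0 < d * Real.log w := by positivity
  have hxC : d * √C * Real.log w = √C * (d * Real.log w) := by ring
  have hxC0 : 0 < d * √C * Real.log w := by positivity
  have hb := log_div_exp_bounds hx.le
  have hb' := log_div_exp_bounds hxC0.le
  have hL := le_sampleLength (C := C) (d := d) (w := w)
  have hm1 : ∀ m' : ℕ, 9 / 10 * (n : ℝ) ≤ m' → 1 ≤ m' := fun m' h => by
    have : (1 : ℝ) ≤ m' := by linarith
    exact_mod_cast this
  -- Collisions in almost all slots up to `√n`, in a constant fraction of them up to `2n`, and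
  -- successes beyond.
  rcases le_or_gt w (√n) with hsmall | hbig
  · have hL1 : 1 ≤ CAB.sampleLength C d w := Nat.ceil_pos.2 hxC0
    refine (tailBound_few_collisions (mlo := 9 / 10 * n) h0 h1 (η := √n / 4) (by positivity)
      (fun m' _ hm' => ?_) hL1 (u := d * √C * Real.log w / (8 * Real.exp 1 ^ 2))
      (by linarith) hR.few hR.delta_le_one).mono le_rfl
      fun s k m' _ h => ⟨h.1, ?_⟩
    · have hy : √(n : ℝ) / 2 ≤ ((m' : ℝ) - 1) * (1 / w) := by
        rw [mul_one_div, le_div_iff₀ hw0]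
        nlinarith
      refine (one_sub_collProb_le h0 h1 (hm1 m' hm')).trans (exp_neg_mul_one_add_le.trans ?_)
      have : Real.exp (-(((m' : ℝ) - 1) * (1 / w) / 2)) ≤ Real.exp (-(√n / 4)) :=
        Real.exp_le_exp.2 (by linarith)
      linarith
    · by_contra hk
      exact h.2 (diagnosis_eq_double hx.le (Or.inr (not_le.1 hk).le))
  · have hx1 := one_le_mul_log_of_sqrt_le hR hbig.le
    have htail := hR.tail w hbig.le
    have hxx : d * Real.log w ≤ √C * (d * Real.log w) := by nlinarith
    rcases lt_or_ge w (2 * n) with hmid | hlarge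
    · refine (tailBound_collisions_lower (mlo := 9 / 10 * n) (r := 6 / 100) h0 h1 (by norm_num)
        (fun m' _ hm' => ?_) (u := d * √C * Real.log w / (8 * Real.exp 1 ^ 2))
        (le_trans (Real.exp_le_exp.2 ?_) htail)).mono le_rfl
        fun s k m' _ h => ⟨h.1, ?_⟩
      · have hy : 44 / 100 ≤ ((m' : ℝ) - 1) * (1 / w) := by
          rw [mul_one_div, le_div_iff₀ hw0]
          linarith
        have := (one_sub_collProb_le h0 h1 (hm1 m' hm')).trans (exp_neg_mul_one_add_le_const hy)
        linarith
      · rw [hxC] at hb' hL ⊢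
        linarith
      · by_contra hk
        exact h.2 (diagnosis_eq_double hx.le (Or.inr (not_le.1 hk).le))
    · refine (tailBound_successes_lower (mlo := 9 / 10 * n) (r := 45 / 100 * (n / w)) h0 h1 ?_
        (fun m' hmm hm' => ?_) (u := d * Real.log w / (20 * Real.exp 1))
        (le_trans (Real.exp_le_exp.2 ?_) htail)).mono le_rfl
        fun s k m' _ h => ⟨h.1, ?_⟩
      · have : (n : ℝ) / w ≤ 1 := by rw [div_le_one hw0]; linarith
        linarith
      · have hmn : (m' : ℝ) ≤ n := by exact_mod_cast hmm.trans hm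
        have h2 := le_succProb_of_mul_le h0 h1 (m := m') (by
          rw [mul_one_div, div_le_div_iff₀ hw0 two_pos]; linarith)
        refine le_trans ?_ h2
        rw [← sub_nonneg]
        have : (m' : ℝ) * (1 / w / 2) - 45 / 100 * (n / w) = (m' - 9 / 10 * n) / (2 * w) := by
          field_simp
          ring
        rw [this]
        exact div_nonneg (by linarith) (by linarith)
      · have h3 : 1 / 4 ≤ n / w * √C := by
          rw [div_mul_eq_mul_div, div_le_div_iff₀ (by norm_num) hw0]
          linarith
        have h4 : n / w * (√C * (d * Real.log w)) ≤ n / w * CAB.sampleLength C d w := by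
          rw [hxC] at hL
          exact mul_le_mul_of_nonneg_left hL (by positivity)
        nlinarith
      · by_contra hk
        exact h.2 (diagnosis_eq_double hx.le (Or.inl (not_le.1 hk)))

/-- A window that is not too large leads to some successes. -/
lemma tailBound_halve (hR : Regime C d δ ℓ wmax n) {w : ℝ} {m : ℕ}
    (hwX : 4 * (n * √C) ≤ w) (hwX' : w ≤ 2048 * (n * √C)) (hm : m ≤ n) :
    TailBound (1 / w) m (CAB.sampleLength C d w) δ fun s k m' =>
      9 / 10 * (n : ℝ) ≤ m' ∧ CAB.diagnosis C d s k w = .halve := by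
  have hn : (100 : ℝ) ≤ n := by exact_mod_cast hR.hundred_le
  have hsC : 1 ≤ √C := Real.one_le_sqrt.2 hR.one_le_C
  have hwn : 4 * (n : ℝ) ≤ w := by nlinarith
  have hw0 : 0 < w := by linarith
  have h0 : 0 ≤ 1 / w := by positivity
  have h1 : 1 / w ≤ 1 := by rw [div_le_one (by linarith)]; linarith
  have hsq : √(n : ℝ) ≤ w := (sqrt_le_self_of_one_le (by linarith)).trans (by linarith)
  have hx1 := one_le_mul_log_of_sqrt_le hR hsq
  have hL := le_sampleLength (C := C) (d := d) (w := w)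
  have hxC : d * √C * Real.log w = √C * (d * Real.log w) := by ring
  refine (tailBound_successes_lower (mlo := 9 / 10 * n) (r := 45 / 100 * (n / w)) h0 h1 ?_
    (fun m' hmm hm' => ?_) (u := 2 * d * Real.log w / 10 ^ 5)
    (le_trans (Real.exp_le_exp.2 ?_) (hR.tail w hsq))).mono le_rfl
    fun s k m' _ h => ⟨h.1, ?_⟩
  · have : (n : ℝ) / w ≤ 1 := by rw [div_le_one hw0]; linarith
    linarith
  · have hmn : (m' : ℝ) ≤ n := by exact_mod_cast hmm.trans hm
    have h2 := le_succProb_of_mul_le h0 h1 (m := m') (by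
      rw [mul_one_div, div_le_div_iff₀ hw0 two_pos]; linarith)
    refine le_trans ?_ h2
    rw [← sub_nonneg]
    have : (m' : ℝ) * (1 / w / 2) - 45 / 100 * (n / w) = (m' - 9 / 10 * n) / (2 * w) := by
      field_simp
      ring
    rw [this]
    exact div_nonneg (by linarith) (by linarith)
  · have h3 : 1 / 2048 ≤ n / w * √C := by
      rw [div_mul_eq_mul_div, div_le_div_iff₀ (by norm_num) hw0]
      linarith
    have h4 : n / w * (√C * (d * Real.log w)) ≤ n / w * CAB.sampleLength C d w := by
      rw [hxC] at hL
      exact mul_le_mul_of_nonneg_left hL (by positivity)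
    have h5 : 2 * d * Real.log w / 10 ^ 5 = 2 * (d * Real.log w) / 10 ^ 5 := by ring
    rw [h5]
    nlinarith
  · by_contra hk
    exact diagnosis_ne_halve (not_le.1 hk) h.2

/-- In a sufficiently large window, successes and collisions are rare. -/
lemma tailBound_double (hR : Regime C d δ ℓ wmax n) {w : ℝ} {m : ℕ}
    (hwX : 512 * (n * √C) ≤ w) (hm : m ≤ n) :
    TailBound (1 / w) m (CAB.sampleLength C d w) (δ + δ) fun s k _ =>
      CAB.diagnosis C d s k w = .double := by
  have hn : (100 : ℝ) ≤ n := by exact_mod_cast hR.hundred_le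
  have hsC : 1 ≤ √C := Real.one_le_sqrt.2 hR.one_le_C
  have hwn : 512 * (n : ℝ) ≤ w := by nlinarith
  have hw0 : 0 < w := by linarith
  have hw1 : 1 < w := by linarith
  have h0 : 0 ≤ 1 / w := by positivity
  have h1 : 1 / w ≤ 1 := by rw [div_le_one (by linarith)]; linarith
  have hsq : √(n : ℝ) ≤ w := (sqrt_le_self_of_one_le (by linarith)).trans (by linarith)
  have hx1 := one_le_mul_log_of_sqrt_le hR hsq
  have hxC : d * √C * Real.log w = √C * (d * Real.log w) := by ring
  have hxx : d * Real.log w ≤ √C * (d * Real.log w) := by nlinarith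
  have hL := sampleLength_le (C := C) (d := d) (w := w) (by rw [hxC]; linarith)
  have hb := log_div_exp_bounds (x := d * Real.log w) (by linarith)
  have hb' := log_div_exp_bounds (x := d * √C * Real.log w) (by rw [hxC]; linarith)
  have hr : n / w * √C ≤ 1 / 512 := by
    rw [div_mul_eq_mul_div, div_le_div_iff₀ hw0 (by norm_num)]
    linarith
  have hr0 : 0 ≤ (n : ℝ) / w := by positivity
  have hr1 : (n : ℝ) / w ≤ 1 / 512 := le_trans (le_mul_of_one_le_right hr0 hsC) hr
  have hS := tailBound_successes_upper (mb := m) (L := CAB.sampleLength C d w) (δ := δ) h0 h1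
    (r := n / w) (by positivity)
    (fun m' hm' => (succProb_le_min hw1 (hm'.trans hm)).trans (min_le_right _ _))
    (u := d * Real.log w / (20 * Real.exp 1)) (le_trans (Real.exp_le_exp.2 (by
      have h4 := mul_le_mul_of_nonneg_left hL hr0
      rw [hxC] at h4
      nlinarith)) (hR.tail w hsq))
  have hK := tailBound_collisions_upper (mb := m) (L := CAB.sampleLength C d w) (δ := δ) h0 h1
    (r := (n / w) ^ 2) (by positivity)
    (fun m' hm' => (collProb_le_min hw1 (hm'.trans hm)).trans
      (pow_le_pow_left₀ (le_min zero_le_one (by positivity)) (min_le_right _ _) 2))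
    (u := d * √C * Real.log w / (8 * Real.exp 1 ^ 2)) (le_trans (Real.exp_le_exp.2 (by
      have h4 := mul_le_mul_of_nonneg_left hL (sq_nonneg ((n : ℝ) / w))
      have h5 : ((n : ℝ) / w) ^ 2 ≤ 1 / 512 ^ 2 := by
        have := pow_le_pow_left₀ hr0 hr1 2
        norm_num at this ⊢
        exact this
      rw [hxC] at h4 hb' ⊢
      nlinarith)) (hR.tail w hsq))
  refine (hS.or hK).mono le_rfl fun s k m' _ h => ?_
  by_contra hk
  push Not at hk
  exact diagnosis_ne_double hk.1 hk.2 h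

/-- In a window that is much too large, there are hardly any successes. -/
lemma tailBound_runDown (hR : Regime C d δ ℓ wmax n) {w : ℝ} {m : ℕ}
    (hwX : 10 ^ 6 * (n * √C) ≤ w) (hm : m ≤ n) :
    TailBound (1 / w) m (CAB.sampleLength C d w) δ fun s k _ =>
      CAB.diagnosis C d s k w = .runDown := by
  have hn : (100 : ℝ) ≤ n := by exact_mod_cast hR.hundred_le
  have hsC : 1 ≤ √C := Real.one_le_sqrt.2 hR.one_le_C
  have hwn : 10 ^ 6 * (n : ℝ) ≤ w := by nlinarith
  have hw0 : 0 < w := by linarith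
  have hw1 : 1 < w := by linarith
  have h0 : 0 ≤ 1 / w := by positivity
  have h1 : 1 / w ≤ 1 := by rw [div_le_one (by linarith)]; linarith
  have hsq : √(n : ℝ) ≤ w := (sqrt_le_self_of_one_le (by linarith)).trans (by linarith)
  have hx1 := one_le_mul_log_of_sqrt_le hR hsq
  have hxC : d * √C * Real.log w = √C * (d * Real.log w) := by ring
  have hxx : d * Real.log w ≤ √C * (d * Real.log w) := by nlinarith
  have hL := sampleLength_le (C := C) (d := d) (w := w) (by rw [hxC]; linarith)
  have hr : n / w * √C ≤ 1 / 10 ^ 6 := by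
    rw [div_mul_eq_mul_div, div_le_div_iff₀ hw0 (by norm_num)]
    linarith
  have hr0 : 0 ≤ (n : ℝ) / w := by positivity
  refine (tailBound_successes_upper h0 h1
    (r := n / w) (by positivity)
    (fun m' hm' => (succProb_le_min hw1 (hm'.trans hm)).trans (min_le_right _ _))
    (u := 2 * d * Real.log w / 10 ^ 5) (le_trans (Real.exp_le_exp.2 ?_) (hR.tail w hsq))).mono
    le_rfl fun s k m' _ h => ?_
  · have h4 := mul_le_mul_of_nonneg_left hL hr0
    rw [hxC] at h4
    have h5 : 2 * d * Real.log w / 10 ^ 5 = 2 * (d * Real.log w) / 10 ^ 5 := by ring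
    rw [h5]
    nlinarith
  · by_contra hk
    exact diagnosis_ne_runDown (not_le.1 hk) h

end Sample

/-! ### The search for the window size -/

section Search

variable {C c d M Mb δ ℓ wmax : ℝ} {n : ℕ}

/-- One sample, given a bound for the probability of a bad outcome. -/
lemma sample_le (hM : 0 ≤ M) {w V κ : ℝ} {m k₀ : ℕ} {Bad : ℕ → ℕ → ℕ → Prop} (hw : 1 < w)
    (hL : 1 ≤ CAB.sampleLength C d w) (hMb : ∀ s m, cabCost C c d M k₀ s m ≤ Mb) (hV : 0 ≤ V)
    (hT : TailBound (1 / w) m (CAB.sampleLength C d w) δ Bad)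
    (hκ : ∀ m' ≤ m, collProb (1 / w) m' ≤ κ)
    (hend : ∀ s k m', m' ≤ m → ¬ Bad s k m' →
      cabCost C c d M k₀ (CAB.afterSample C c d s k w) m' ≤ V) :
    cabCost C c d M (k₀ + CAB.sampleLength C d w) (.sample w (CAB.sampleLength C d w) 0 0) m ≤
      CAB.sampleLength C d w * κ + V + Mb * δ := by
  have hq1 : 1 / w ≤ 1 := (div_le_one (by linarith)).2 hw.le
  have hq0 : 0 ≤ 1 / w := by positivity
  have := costToGo_block (P := collisionAversionBackoff C c d) hM (V := V) (Mb := Mb) (k₀ := k₀)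
    (κ := κ)
    (fun l s k => match l with
      | 0 => CAB.afterSample C c d s k w
      | l + 1 => CAB.State.sample w (l + 1) s k) hq0 hq1 (fun _ _ _ => rfl)
    (fun l _ _ => by cases l <;> simp [collisionAversionBackoff, CAB.next])
    (fun l _ _ => by cases l <;> simp [collisionAversionBackoff, CAB.next])
    (fun l _ _ => by cases l <;> simp [collisionAversionBackoff, CAB.next])
    hκ hT hV hMb hend
  obtain ⟨L, hL'⟩ : ∃ L, CAB.sampleLength C d w = L + 1 :=
    ⟨CAB.sampleLength C d w - 1, by omega⟩
  rw [hL'] at this ⊢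
  simpa using this

/-- Decompose `k` slots into the slots of a sample and the rest, with the regime's bounds for the
length of a sample and for the expected number of collisions in it. -/
lemma sample_le_of_regime (hR : Regime C d δ ℓ wmax n) (hM : 0 ≤ M) {N : ℕ}
    (hMb : ∀ k ≤ N, ∀ s m, cabCost C c d M k s m ≤ Mb) {w V T : ℝ} {m k : ℕ}
    {Bad : ℕ → ℕ → ℕ → Prop} (hw : 1 < w) (hwC : C ≤ w ∨ n * √C ≤ w) (hwmax : w ≤ wmax)
    (hm : m ≤ n) (hV : 0 ≤ V) (hT : 0 ≤ T) (hk : √C * ℓ + T ≤ k) (hkN : k ≤ N)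
    (hBad : TailBound (1 / w) m (CAB.sampleLength C d w) (4 * δ) Bad)
    (hend : ∀ k₀ : ℕ, k₀ ≤ N → T ≤ k₀ → ∀ s k m', m' ≤ m → ¬ Bad s k m' →
      cabCost C c d M k₀ (CAB.afterSample C c d s k w) m' ≤ V) :
    cabCost C c d M k (.sample w (CAB.sampleLength C d w) 0 0) m ≤
      (ℓ * (n / √C) + Mb * (4 * δ)) + V := by
  have hn : 1 ≤ n := le_trans (by norm_num) hR.hundred_le
  have hsC : 1 ≤ √C := Real.one_le_sqrt.2 hR.one_le_C
  have hlen := hR.length_le w hw hwmax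
  have hd := hR.one_le_d
  have hlog : 0 < Real.log w := Real.log_pos hw
  have hL : 1 ≤ CAB.sampleLength C d w := Nat.ceil_pos.2 (by positivity)
  have hℓ : 0 ≤ ℓ := by
    have : 0 ≤ √C * ℓ := (Nat.cast_nonneg _).trans hlen
    exact nonneg_of_mul_nonneg_right this (by linarith)
  obtain ⟨k₀, rfl⟩ : ∃ k₀, k = k₀ + CAB.sampleLength C d w := by
    refine ⟨k - CAB.sampleLength C d w, ?_⟩
    have : (CAB.sampleLength C d w : ℝ) ≤ k := by linarith
    have : CAB.sampleLength C d w ≤ k := by exact_mod_cast this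
    omega
  push_cast at hk
  have h := sample_le (c := c) hM hw hL (hMb k₀ (by omega)) hV hBad
    (fun m' hm' => collProb_le_min hw (hm'.trans hm)) (hend k₀ (by omega) (by linarith))
  have hcoll : CAB.sampleLength C d w * min 1 ((n : ℝ) / w) ^ 2 ≤ ℓ * (n / √C) := by
    have h1 := sqrt_mul_min_le hR.one_le_C hn hwC
    have h0 : 0 ≤ min 1 ((n : ℝ) / w) := le_min zero_le_one (by positivity)
    have h2 := pow_le_pow_left₀ (by positivity) h1 2
    rw [Real.sq_sqrt (Nat.cast_nonneg n)] at h2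
    calc CAB.sampleLength C d w * min 1 ((n : ℝ) / w) ^ 2
        ≤ √C * ℓ * min 1 ((n : ℝ) / w) ^ 2 := mul_le_mul_of_nonneg_right hlen (by positivity)
      _ = ℓ * ((√C * min 1 ((n : ℝ) / w)) ^ 2 / √C) := by field_simp
      _ ≤ ℓ * (n / √C) := by gcongr
  linarith

/-- The search from above: a window that is larger than `512 n √C` is halved until RunDown
starts. -/
lemma search_down (hR : Regime C d δ ℓ wmax n) (hδ : 0 ≤ δ) (hM : 0 ≤ M) (hMb0 : 0 ≤ Mb) {N : ℕ}
    (hMb : ∀ k ≤ N, ∀ s m, cabCost C c d M k s m ≤ Mb) {V T : ℝ} (hV : 0 ≤ V) (hT : 0 ≤ T)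
    (hrun : ∀ (w : ℝ) (m k : ℕ), 4 * (n * √C) ≤ w → w ≤ 10 ^ 6 * (n * √C) → m ≤ n → T ≤ (k : ℝ) → k ≤ N →
      cabCost C c d M k (CAB.beginRun C c w w) m ≤ V)
    (j : ℕ) (w : ℝ) (m k : ℕ) (hw : 512 * (n * √C) ≤ w) (hj : w ≤ 2 ^ j * (2048 * (n * √C)))
    (hwmax : w ≤ wmax) (hm : 9 / 10 * (n : ℝ) + (j + 1) * (3 * √n * ℓ) ≤ m) (hmn : m ≤ n)
    (hk : (j + 1) * (√C * ℓ) + T ≤ k) (hkN : k ≤ N) :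
    cabCost C c d M k (.sample w (CAB.sampleLength C d w) 0 0) m ≤
      (j + 1) * (ℓ * (n / √C) + Mb * (4 * δ)) + V := by
  have hn : (100 : ℝ) ≤ n := by exact_mod_cast hR.hundred_le
  have hsC : 1 ≤ √C := Real.one_le_sqrt.2 hR.one_le_C
  have hX : (n : ℝ) ≤ n * √C := le_mul_of_one_le_right (by linarith) hsC
  have hℓ : 0 ≤ ℓ := by
    have : 0 ≤ √C * ℓ := (Nat.cast_nonneg _).trans (hR.length_le w (by linarith) hwmax)
    exact nonneg_of_mul_nonneg_right this (by linarith)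
  have hunit : 0 ≤ ℓ * (n / √C) + Mb * (4 * δ) := by positivity
  have hh : 0 ≤ 3 * √n * ℓ := by positivity
  have hLs : 0 ≤ √C * ℓ := by positivity
  -- The outcomes excluded by the tail bounds: a great loss, doubling, halving of a window that is
  -- not too large and RunDown with a window that is much too large.
  have hT4 : ∀ (w : ℝ) (m : ℕ), 512 * (n * √C) ≤ w → w ≤ wmax → m ≤ n →
      TailBound (1 / w) m (CAB.sampleLength C d w) (4 * δ) fun s k m' =>
      (m' + 3 * √n * ℓ ≤ m ∨ CAB.diagnosis C d s k w = .double) ∨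
        (w ≤ 2048 * (n * √C) ∧ 9 / 10 * (n : ℝ) ≤ m' ∧ CAB.diagnosis C d s k w = .halve ∨
          10 ^ 6 * (n * √C) ≤ w ∧ CAB.diagnosis C d s k w = .runDown) := by
    intro w m hw hwmax hmn
    have hloss := tailBound_sample_loss hR (w := w) (by linarith) (Or.inr (by linarith)) hwmax hmn
    have hdbl := tailBound_double hR (w := w) hw hmn
    rcases le_or_gt w (2048 * (n * √C)) with h | h
    · refine ((hloss.or hdbl).or (tailBound_halve hR (w := w) (by linarith) h hmn)).mono
        (by linarith) fun s k m' _ hB => ?_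
      rcases hB with hB | hB | hB
      · exact Or.inl hB
      · exact Or.inr hB.2
      · linarith [hB.1]
    · by_cases h6 : 10 ^ 6 * (n * √C) ≤ w
      · refine ((hloss.or hdbl).or (tailBound_runDown hR (w := w) h6 hmn)).mono
          (by linarith) fun s k m' _ hB => ?_
        rcases hB with hB | hB | hB
        · exact Or.inl hB
        · exact absurd hB.1 (not_le.2 h)
        · exact Or.inr hB.2
      · refine (hloss.or hdbl).mono (by linarith) fun s k m' _ hB => ?_
        rcases hB with hB | hB | hB
        · exact hB
        · exact absurd hB.1 (not_le.2 h)
        · exact absurd hB.1 h6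
  induction j generalizing w m k with
  | zero =>
    rw [pow_zero, one_mul] at hj
    norm_num at hm hk
    have := sample_le_of_regime (c := c) hR hM hMb (V := V) (T := T) (by linarith)
      (Or.inr (by linarith)) hwmax hmn hV hT hk hkN (hT4 w m hw hwmax hmn) fun k₀ hk₀ hTk s k m' hm' hB => by
        push Not at hB
        have h9 : 9 / 10 * (n : ℝ) ≤ m' := by linarith [hB.1.1]
        have hnh := hB.2.1 hj h9
        have hnd := hB.1.2
        unfold CAB.afterSample
        cases hdiag : CAB.diagnosis C d s k w with
        | double => exact absurd hdiag hnd
        | halve => exact absurd hdiag hnh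
        | runDown => exact hrun w m' k₀ (by linarith) (by linarith) (hm'.trans hmn) hTk hk₀
    simpa using this
  | succ j ih =>
    push_cast at hm hk
    have := sample_le_of_regime (c := c) hR hM hMb
      (V := (j + 1) * (ℓ * (n / √C) + Mb * (4 * δ)) + V) (T := (j + 1) * (√C * ℓ) + T)
      (by linarith) (Or.inr (by linarith)) hwmax hmn (by positivity) (by positivity)
      (by linarith) hkN (hT4 w m hw hwmax hmn) fun k₀ hk₀ hTk s k m' hm' hB => by
        push Not at hB
        have hjh : 0 ≤ (j : ℝ) * (3 * √n * ℓ) := by positivity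
        have h9 : 9 / 10 * (n : ℝ) + (j + 1) * (3 * √n * ℓ) ≤ m' := by linarith [hB.1.1]
        have hnd := hB.1.2
        unfold CAB.afterSample
        cases hdiag : CAB.diagnosis C d s k w with
        | double => exact absurd hdiag hnd
        | halve =>
          have hw2 : 2048 * (n * √C) < w := by
            by_contra hcon
            exact hB.2.1 (not_lt.1 hcon) (by linarith) hdiag
          simp only
          rw [beginSample_of_one_lt (by linarith)]
          rw [pow_succ] at hj
          exact ih (w / 2) m' k₀ (by linarith) (by linarith) (by linarith) h9 (hm'.trans hmn)
            hTk hk₀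
        | runDown =>
          have h6 : w < 10 ^ 6 * (n * √C) := by
            by_contra hcon
            exact hB.2.2 (not_lt.1 hcon) hdiag
          have h1 := hrun w m' k₀ (by linarith) h6.le (hm'.trans hmn)
            (by have : 0 ≤ ((j : ℝ) + 1) * (√C * ℓ) := by positivity
                linarith) hk₀
          have h2 : 0 ≤ ((j : ℝ) + 1) * (ℓ * (n / √C) + Mb * (4 * δ)) := by positivity
          simp only
          linarith
    push_cast
    linarith

/-- The search from below: a window that is smaller than `512 n √C` is doubled until RunDown
starts. -/
lemma search_up (hR : Regime C d δ ℓ wmax n) (hδ : 0 ≤ δ) (hM : 0 ≤ M) (hMb0 : 0 ≤ Mb) {N : ℕ}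
    (hMb : ∀ k ≤ N, ∀ s m, cabCost C c d M k s m ≤ Mb) {V T : ℝ} (hV : 0 ≤ V) (hT : 0 ≤ T)
    (hrun : ∀ (w : ℝ) (m k : ℕ), 4 * (n * √C) ≤ w → w ≤ 10 ^ 6 * (n * √C) → m ≤ n → T ≤ (k : ℝ) → k ≤ N →
      cabCost C c d M k (CAB.beginRun C c w w) m ≤ V)
    (hmax : 1024 * (n * √C) ≤ wmax)
    (j : ℕ) (w : ℝ) (m k : ℕ) (hCw : C ≤ w) (hw1 : 1 < w) (hw : w < 512 * (n * √C))
    (hj : 512 * (n * √C) ≤ 2 ^ j * w)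
    (hm : 9 / 10 * (n : ℝ) + (j + 1) * (3 * √n * ℓ) ≤ m) (hmn : m ≤ n)
    (hk : (j + 1) * (√C * ℓ) + T ≤ k) (hkN : k ≤ N) :
    cabCost C c d M k (.sample w (CAB.sampleLength C d w) 0 0) m ≤
      (j + 1) * (ℓ * (n / √C) + Mb * (4 * δ)) + V := by
  have hn : (100 : ℝ) ≤ n := by exact_mod_cast hR.hundred_le
  have hsC : 1 ≤ √C := Real.one_le_sqrt.2 hR.one_le_C
  have hX : (n : ℝ) ≤ n * √C := le_mul_of_one_le_right (by linarith) hsC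
  have hℓ : 0 ≤ ℓ := by
    have : 0 ≤ √C * ℓ := (Nat.cast_nonneg _).trans (hR.length_le w hw1 (by linarith))
    exact nonneg_of_mul_nonneg_right this (by linarith)
  have hunit : 0 ≤ ℓ * (n / √C) + Mb * (4 * δ) := by positivity
  have hh : 0 ≤ 3 * √n * ℓ := by positivity
  have hLs : 0 ≤ √C * ℓ := by positivity
  induction j generalizing w m k with
  | zero =>
    rw [pow_zero, one_mul] at hj
    linarith
  | succ j ih =>
    have hwmax : w ≤ wmax := by linarith
    have hT4 : TailBound (1 / w) m (CAB.sampleLength C d w) (4 * δ) fun s k m' =>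
        m' + 3 * √n * ℓ ≤ m ∨ (w < 4 * (n * √C) ∧ 9 / 10 * (n : ℝ) ≤ m' ∧
            CAB.diagnosis C d s k w ≠ .double ∨
          4 * (n * √C) ≤ w ∧ 9 / 10 * (n : ℝ) ≤ m' ∧ CAB.diagnosis C d s k w = .halve) := by
      have hloss := tailBound_sample_loss hR hw1 (Or.inl hCw) hwmax hmn
      rcases lt_or_ge w (4 * (n * √C)) with h | h
      · refine (hloss.or (tailBound_not_double hR hw1 h hmn)).mono (by linarith)
          fun s k m' _ hB => ?_
        rcases hB with hB | hB | hB
        · exact Or.inl hB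
        · exact Or.inr hB.2
        · exact absurd hB.1 (not_le.2 h)
      · refine (hloss.or (tailBound_halve hR h (by linarith) hmn)).mono (by linarith)
          fun s k m' _ hB => ?_
        rcases hB with hB | hB | hB
        · exact Or.inl hB
        · exact absurd hB.1 (not_lt.2 h)
        · exact Or.inr hB.2
    push_cast at hm hk
    have := sample_le_of_regime (c := c) hR hM hMb
      (V := (j + 1) * (ℓ * (n / √C) + Mb * (4 * δ)) + V) (T := (j + 1) * (√C * ℓ) + T)
      hw1 (Or.inl hCw) hwmax hmn (by positivity) (by positivity)
      (by linarith) hkN hT4 fun k₀ hk₀ hTk s k m' hm' hB => by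
        push Not at hB
        have hjh : 0 ≤ (j : ℝ) * (3 * √n * ℓ) := by positivity
        have hjL : 0 ≤ (j : ℝ) * (√C * ℓ) := by positivity
        have hju : 0 ≤ (j : ℝ) * (ℓ * (n / √C) + Mb * (4 * δ)) := by positivity
        have h9 : 9 / 10 * (n : ℝ) + (j + 1) * (3 * √n * ℓ) ≤ m' := by linarith [hB.1]
        unfold CAB.afterSample
        cases hdiag : CAB.diagnosis C d s k w with
        | double =>
          simp only
          rw [beginSample_of_one_lt (by linarith)]
          rcases lt_or_ge (2 * w) (512 * (n * √C)) with h | h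
          · rw [pow_succ] at hj
            exact ih (2 * w) m' k₀ (by linarith) (by linarith) h (by linarith) h9
              (hm'.trans hmn) hTk hk₀
          · have := search_down (c := c) hR hδ hM hMb0 hMb hV hT hrun 0 (2 * w) m' k₀ h
              (by rw [pow_zero, one_mul]; linarith) (by linarith)
              (by push_cast; linarith) (hm'.trans hmn) (by push_cast; linarith) hk₀
            push_cast at this
            linarith
        | halve =>
          rcases lt_or_ge w (4 * (n * √C)) with h | h
          · have := hB.2.1 h (by linarith)
            rw [hdiag] at this
            cases this
          · exact absurd hdiag (hB.2.2 h (by linarith))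
        | runDown =>
          rcases lt_or_ge w (4 * (n * √C)) with h | h
          · have := hB.2.1 h (by linarith)
            rw [hdiag] at this
            cases this
          · have h1 := hrun w m' k₀ h (by linarith) (hm'.trans hmn) (by linarith) hk₀
            simp only
            linarith
    push_cast
    linarith

end Search

/-! ### Choice of the constants -/

section Constants

variable {κ B C c d l M : ℝ} {n : ℕ}

lemma two_le_log (hn : 1000 ≤ n) (hl : l = Real.log n) : 2 ≤ l := by
  have h : (1000 : ℝ) ≤ n := by exact_mod_cast hn
  rw [hl, Real.le_log_iff_exp_le (by linarith)]
  have h1 : Real.exp 2 = Real.exp 1 * Real.exp 1 := by rw [← Real.exp_add]; norm_num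
  have := Real.exp_one_lt_d9
  have := Real.exp_pos 1
  nlinarith

lemma exp_log_natCast (hn : 1000 ≤ n) (hl : l = Real.log n) : Real.exp l = n := by
  have h : (1000 : ℝ) ≤ n := by exact_mod_cast hn
  rw [hl, Real.exp_log (by linarith)]

lemma sqrt_le_exp (hC : 1 ≤ C) (hCn : C ≤ Real.exp (κ * l)) : √C ≤ Real.exp (κ * l) :=
  (sqrt_le_self_of_one_le hC).trans hCn

/-- All windows of RunDown, and those that the search from below can reach, are at most
`n ^ (κ + 3)`. -/
lemma window_le_exp (hC : 1 ≤ C) (hn : 1000 ≤ n) (hl : l = Real.log n)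
    (hCn : C ≤ Real.exp (κ * l)) : 10 ^ 6 * (n * √C) ≤ Real.exp ((κ + 3) * l) := by
  have h : (1000 : ℝ) ≤ n := by exact_mod_cast hn
  have h1 : Real.exp ((κ + 3) * l) = n * n * (n * Real.exp (κ * l)) := by
    rw [← exp_log_natCast hn hl, ← Real.exp_add, ← Real.exp_add, ← Real.exp_add]
    ring_nf
  rw [h1]
  have h2 := sqrt_le_exp hC hCn
  have h3 : (10 : ℝ) ^ 6 ≤ n * n := by nlinarith
  exact mul_le_mul h3 (mul_le_mul_of_nonneg_left h2 (by linarith)) (by positivity) (by positivity)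

/-- A number of doublings that is logarithmic in `n` and exceeds the range of the windows. -/
lemma exists_doublings (hκ : 0 ≤ κ) (hl : 2 ≤ l) :
    ∃ J : ℕ, Real.exp ((κ + 3) * l) ≤ 2 ^ J ∧ (J : ℝ) + 1 ≤ 2 * (κ + 4) * l := by
  have h2 := Real.log_two_gt_d9
  refine ⟨⌈(κ + 3) * l / Real.log 2⌉₊, ?_, ?_⟩
  · rw [← Real.rpow_natCast, Real.rpow_def_of_pos two_pos]
    refine Real.exp_le_exp.2 ?_
    have := Nat.le_ceil ((κ + 3) * l / Real.log 2)
    rw [div_le_iff₀ (by linarith)] at this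
    linarith
  · have h3 := (Nat.ceil_lt_add_one (a := (κ + 3) * l / Real.log 2) (by positivity)).le
    have h4 : (κ + 3) * l / Real.log 2 ≤ 3 / 2 * ((κ + 3) * l) := by
      rw [div_le_iff₀ (by linarith)]
      have : 0 ≤ (κ + 3) * l := by positivity
      nlinarith
    nlinarith

lemma regime_of_large (hκ : 0 ≤ κ) (hB : 1 ≤ B) (hd : 2 * 10 ^ 5 * B ≤ d) (hC : 1 ≤ C)
    (hn : 1000 ≤ n) (hl : l = Real.log n)
    (hfew : 3 * Real.exp (-(√n / 4 / 2)) ≤ Real.exp (-(B * l))) :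
    Regime C d (Real.exp (-(B * l))) (d * (κ + 3) * l + 1) (Real.exp ((κ + 3) * l)) n := by
  have hl2 := two_le_log hn hl
  have hnr : (1000 : ℝ) ≤ n := by exact_mod_cast hn
  have hd1 : 1 ≤ d := by linarith
  have hsC : 1 ≤ √C := Real.one_le_sqrt.2 hC
  have hBl : 0 ≤ B * l := by positivity
  refine ⟨hC, hd1, by omega, Real.exp_le_one_iff.2 (by linarith), hfew, fun w hw => ?_, ?_,
    fun w hw hwm => ?_⟩
  · refine Real.exp_le_exp.2 ?_
    have hsn : 0 < √(n : ℝ) := Real.sqrt_pos.2 (by linarith)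
    have h1 := Real.log_le_log hsn hw
    rw [Real.log_sqrt (by linarith), ← hl] at h1
    have h2 : 2 * 10 ^ 5 * B * (l / 2) ≤ d * Real.log w :=
      mul_le_mul hd h1 (by linarith) (by linarith)
    rw [neg_le_neg_iff, le_div_iff₀ (by norm_num)]
    linarith
  · refine Real.exp_le_exp.2 (neg_le_neg ?_)
    have h1 : 1 ≤ √(n : ℝ) := Real.one_le_sqrt.2 (by linarith)
    have h2 : B * l ≤ d * (κ + 3) * l + 1 := by
      have : B ≤ d * (κ + 3) := by nlinarith
      nlinarith
    nlinarith
  · have hlog : 0 < Real.log w := Real.log_pos hw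
    have h1 : Real.log w ≤ (κ + 3) * l := by
      rw [Real.log_le_iff_le_exp (by linarith)]; exact hwm
    have h2 := Nat.ceil_lt_add_one (a := d * √C * Real.log w) (by positivity)
    have h3 : d * √C * Real.log w ≤ d * √C * ((κ + 3) * l) :=
      mul_le_mul_of_nonneg_left h1 (by positivity)
    unfold CAB.sampleLength
    nlinarith

/-- The bound for the cost-to-go of RunDown in terms of the constants. -/
noncomputable def runDownConst (κ B c : ℝ) : ℝ :=
  2 * 10 ^ 6 + 10 ^ 4 * B ^ 2 + 4 * (κ + 4) + 4 * c * (κ + 3) + 2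

/-- Factor of `n √C log n` in the bound for the duration of RunDown. -/
noncomputable def runDownTime (κ c : ℝ) : ℝ := 10 ^ 6 * (4 + 4 * c * (κ + 3))

/-- RunDown with a window of the right order of magnitude. If `w₀` is below half of the
threshold of the loop, `beginRun_le` does not apply, but then the loop is skipped. -/
lemma runDown_le (hκ : 0 ≤ κ) (hB : 1 ≤ B) (hc : B ≤ c) (hC : 1 ≤ C)
    (hn : 1000 ≤ n) (hl : l = Real.log n) (hCn : C ≤ Real.exp (κ * l)) (hM : 0 ≤ M)
    (hMδ : M * Real.exp (-(B * l)) * n ≤ 1 / √C) {N : ℕ}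
    (hMb : ∀ k ≤ N, ∀ s m, cabCost C c d M k s m ≤ 2 * M) (w₀ : ℝ) (m k : ℕ)
    (hw : 4 * (n * √C) ≤ w₀) (hw' : w₀ ≤ 10 ^ 6 * (n * √C)) (hm : m ≤ n)
    (hk : runDownTime κ c * (n * √C * l) ≤ k) (hkN : k ≤ N) :
    cabCost C c d M k (CAB.beginRun C c w₀ w₀) m ≤ runDownConst κ B c * (n * l / √C) := by
  have hl2 := two_le_log hn hl
  have hnr : (1000 : ℝ) ≤ n := by exact_mod_cast hn
  have hsC : 1 ≤ √C := Real.one_le_sqrt.2 hC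
  have hsqC : √C * √C = C := Real.mul_self_sqrt (by linarith)
  have hX : (n : ℝ) ≤ n * √C := le_mul_of_one_le_right (by linarith) hsC
  have hw0 : 0 < w₀ := by linarith
  have hc0 : 0 < c := by linarith
  have hlogU : Real.log w₀ ≤ (κ + 3) * l := by
    rw [Real.log_le_iff_le_exp hw0]
    exact hw'.trans (window_le_exp hC hn hl hCn)
  have hlogL : l ≤ Real.log w₀ := by
    rw [hl]
    exact Real.log_le_log (by linarith) (by linarith)
  have h2 := Real.log_two_gt_d9
  have h2' := Real.log_two_lt_d9
  have hlogb : l ≤ Real.logb 2 w₀ := by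
    rw [Real.logb, le_div_iff₀ (by linarith)]
    exact (mul_le_of_le_one_right (by linarith) (by linarith)).trans hlogL
  obtain ⟨J, hJ1, hJ2⟩ := exists_doublings hκ hl2
  set δ := Real.exp (-(B * l)) with hδ
  have hδ0 : 0 < δ := Real.exp_pos _
  set F := ⌈c * Real.log w₀⌉₊ * ⌈w₀⌉₊ with hF
  have hceil : (⌈w₀⌉₊ : ℝ) ≤ 2 * w₀ := by linarith [Nat.ceil_lt_add_one hw0.le]
  have hclog : 1 ≤ c * Real.log w₀ :=
    one_le_mul_of_one_le_of_one_le (by linarith) (by linarith)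
  have hceil' : (⌈c * Real.log w₀⌉₊ : ℝ) ≤ 2 * (c * ((κ + 3) * l)) := by
    have := Nat.ceil_lt_add_one (a := c * Real.log w₀) (by linarith)
    have := mul_le_mul_of_nonneg_left hlogU hc0.le
    linarith
  have hF1 : 1 ≤ F := Nat.mul_pos (Nat.ceil_pos.2 (by linarith)) (Nat.ceil_pos.2 hw0)
  have hFle : (F : ℝ) ≤ 4 * c * (κ + 3) * l * w₀ := by
    rw [hF]
    push_cast
    have := mul_le_mul hceil' hceil (Nat.cast_nonneg _) (by positivity)
    linarith
  have hFge : B * l ≤ F / w₀ := by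
    rw [le_div_iff₀ hw0, hF]
    push_cast
    have h3 : B * l ≤ ⌈c * Real.log w₀⌉₊ :=
      (mul_le_mul hc hlogL (by linarith) hc0.le).trans (Nat.le_ceil _)
    exact mul_le_mul h3 (Nat.le_ceil _) hw0.le (Nat.cast_nonneg _)
  have hu0 : 0 < √C := by linarith
  -- the final windows of size `w₀`
  set V₄ := 4 * c * (κ + 3) * (n * l / √C) + 2 / √C with hV₄
  have hV₄0 : 0 ≤ V₄ := by positivity
  have hfin : ∀ k ≤ N, F ≤ k → ∀ w m, m ≤ n →
      cabCost C c d M k (.finish w₀ w F) m ≤ V₄ := by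
    intro k hk hFk w m hm
    obtain ⟨k₀, rfl⟩ : ∃ k₀, k = k₀ + F := ⟨k - F, by omega⟩
    refine (finish_le hM (by linarith) (by linarith) hm (hMb k₀ (by omega)) hF1).trans ?_
    have h3 : (F : ℝ) * (2 * n / w₀) ^ 2 ≤ 4 * c * (κ + 3) * (n * l / √C) := by
      calc (F : ℝ) * (2 * n / w₀) ^ 2 ≤ 4 * c * (κ + 3) * l * w₀ * (2 * n / w₀) ^ 2 :=
            mul_le_mul_of_nonneg_right hFle (by positivity)
        _ = 16 * c * (κ + 3) * l * n * (n / w₀) := by field_simp; ring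
        _ ≤ 16 * c * (κ + 3) * l * n * (n / (4 * (n * √C))) := by gcongr
        _ = _ := by field_simp; ring
    have h4 : 2 * M * (n * Real.exp (-(F / w₀))) ≤ 2 / √C := by
      calc 2 * M * (n * Real.exp (-(F / w₀))) ≤ 2 * M * (n * δ) := by
            have := Real.exp_le_exp.2 (neg_le_neg hFge)
            gcongr
        _ = 2 * (M * δ * n) := by ring
        _ ≤ 2 * (1 / √C) := by linarith
        _ = _ := by ring
    linarith
  set wmin := 8 * √C * Real.logb 2 w₀ with hwmin
  have hwminL : 8 * √C * l ≤ wmin := mul_le_mul_of_nonneg_left hlogb (by positivity)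
  have hwmin8 : 8 ≤ wmin := by
    have : 1 ≤ √C * l := one_le_mul_of_one_le_of_one_le hsC (by linarith)
    linarith
  have hMδ' : M * δ ≤ 1 / √C :=
    (le_mul_of_one_le_right (by positivity) (by linarith)).trans hMδ
  have h3 : 1 / √C ≤ n * l / √C := by
    gcongr
    exact one_le_mul_of_one_le_of_one_le (by linarith) (by linarith)
  have h3' : l / √C ≤ n * l / √C := by
    gcongr
    exact le_mul_of_one_le_left (by linarith) (by linarith)
  by_cases hbig : w₀ < wmin / 2
  · rw [CAB.beginRun, if_neg (not_le.2 (by linarith)), ← hF]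
    have hFk : F ≤ k := by
      have : (F : ℝ) ≤ k := by
        refine hFle.trans (le_trans ?_ hk)
        have h4 : 4 * c * (κ + 3) * l * w₀ ≤ 4 * c * (κ + 3) * l * (10 ^ 6 * (n * √C)) := by
          gcongr
        have h5 : 0 ≤ 4 * (10 ^ 6 * (n * √C * l)) := by positivity
        unfold runDownTime
        linarith
      exact_mod_cast this
    refine (hfin k hkN hFk w₀ m hm).trans ?_
    have h4 : 0 ≤ (2 * 10 ^ 6 + 10 ^ 4 * B ^ 2 + 4 * (κ + 4)) * (n * l / √C) := by positivity
    have h5 : V₄ = 4 * c * (κ + 3) * (n * l / √C) + 2 * (1 / √C) := by rw [hV₄]; ring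
    rw [h5]
    unfold runDownConst
    linarith
  · have h := beginRun_le (c := c) hC hM (by linarith : 0 ≤ 2 * M) (Λ := 50 * (B * l)) hwmin
      hwmin8 hF hδ0.le
      (le_of_eq (by rw [hδ]; congr 1; ring)) hMb hV₄0 hfin J w₀ m k ?_ (not_lt.1 hbig) hm ?_ ?_ hkN
    · refine h.trans ?_
      have h4 : 2 * w₀ / C ≤ 2 * 10 ^ 6 * (n * l / √C) := by
        have hln : (n : ℝ) ≤ n * l := le_mul_of_one_le_right (by linarith) (by linarith)
        calc 2 * w₀ / C ≤ 2 * (10 ^ 6 * (n * √C)) / C := by gcongr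
          _ = 2 * 10 ^ 6 * (n / √C) := by
              nth_rw 2 [← hsqC]
              field_simp
          _ ≤ _ := by gcongr
      have h5 : 16 * (50 * (B * l)) ^ 2 * (2 / wmin - 1 / w₀) ≤ 10 ^ 4 * B ^ 2 * (n * l / √C) := by
        calc 16 * (50 * (B * l)) ^ 2 * (2 / wmin - 1 / w₀)
            ≤ 16 * (50 * (B * l)) ^ 2 * (2 / (8 * √C * l)) := by
              refine mul_le_mul_of_nonneg_left ?_ (by positivity)
              have h6 : 2 / wmin ≤ 2 / (8 * √C * l) := by gcongr
              have h7 : 0 ≤ 1 / w₀ := by positivity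
              linarith
          _ = 10 ^ 4 * B ^ 2 * (l / √C) := by field_simp; ring
          _ ≤ _ := by gcongr
      have h6 : (J : ℝ) * (2 * M * δ) ≤ 4 * (κ + 4) * (n * l / √C) := by
        calc (J : ℝ) * (2 * M * δ) = J * (2 * (M * δ)) := by ring
          _ ≤ (2 * (κ + 4) * l) * (2 * (1 / √C)) :=
              mul_le_mul (by linarith) (by linarith) (by positivity) (by positivity)
          _ = 4 * (κ + 4) * (l / √C) := by ring
          _ ≤ _ := by gcongr
      have h7 : V₄ = 4 * c * (κ + 3) * (n * l / √C) + 2 * (1 / √C) := by rw [hV₄]; ring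
      rw [h7]
      unfold runDownConst
      linarith
    · have h3 := hw'.trans ((window_le_exp hC hn hl hCn).trans hJ1)
      exact lt_of_le_of_lt h3 (lt_mul_of_one_lt_right (by positivity) (by linarith))
    · left
      rw [le_div_iff₀ (by positivity)]
      have hmn : (m : ℝ) ≤ n := by exact_mod_cast hm
      have := mul_le_mul_of_nonneg_right hmn (by positivity : 0 ≤ 4 * √C)
      linarith
    · refine le_trans ?_ hk
      have h4 : 4 * c * (κ + 3) * l * w₀ ≤ 4 * c * (κ + 3) * l * (10 ^ 6 * (n * √C)) := by
        gcongr
      have h5 : (n : ℝ) * √C ≤ n * √C * l := le_mul_of_one_le_right (by positivity) (by linarith)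
      unfold runDownTime
      linarith

/-- Factor of `n √C log n` in the bound for the makespan. -/
noncomputable def makespanConst (κ c d : ℝ) : ℝ :=
  2 * (κ + 4) * (d * (κ + 3) + 1) + runDownTime κ c + 1

/-- Factor of `n log² n / √C` in the bound for the number of collisions. -/
noncomputable def collisionConst (κ B c d : ℝ) : ℝ :=
  2 * (κ + 4) * (d * (κ + 3) + 9) + runDownConst κ B c

/-- The first sample: its window size is `C`, or `2` if `C = 1`. -/
lemma exists_start (C d : ℝ) (hC : 1 ≤ C) :
    ∃ w, CAB.beginSample C d C = .sample w (CAB.sampleLength C d w) 0 0 ∧ C ≤ w ∧ 1 < w ∧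
      (w = C ∨ w = 2) := by
  rcases hC.eq_or_lt with h | h
  · refine ⟨2, ?_, by linarith, by norm_num, Or.inr rfl⟩
    have h1 : sInf {k : ℕ | 1 < (2 : ℝ) ^ k * 1} = 1 := by
      apply le_antisymm
      · exact Nat.sInf_le (by norm_num)
      · refine le_csInf ⟨1, by norm_num⟩ fun k hk => ?_
        by_contra h0
        have : k = 0 := by omega
        subst this
        norm_num at hk
    rw [← h, CAB.beginSample, h1]
    norm_num
  · exact ⟨C, beginSample_of_one_lt h, le_rfl, h, Or.inl rfl⟩

/-- The cost-to-go of the whole protocol. -/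
lemma cabCost_start_le (hκ : 0 ≤ κ) (hB : 1 ≤ B) (hc : B ≤ c) (hd : 2 * 10 ^ 5 * B ≤ d)
    (hC : 1 ≤ C) (hn : 1000 ≤ n) (hl : l = Real.log n) (hCn : C ≤ Real.exp (κ * l)) (hM : 0 ≤ M)
    (hMδ : M * Real.exp (-(B * l)) * n ≤ 1 / √C)
    (hfew : 3 * Real.exp (-(√n / 4 / 2)) ≤ Real.exp (-(B * l)))
    (hloss : 2 * (κ + 4) * l * (3 * √n * ((d * (κ + 3) + 1) * l)) ≤ n / 10) {N : ℕ}
    (hN : N = ⌊makespanConst κ c d * (n * √C * l)⌋₊) (hNM : (N : ℝ) ≤ M) :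
    cabCost C c d M N (CAB.beginSample C d C) n ≤
      collisionConst κ B c d * (n * l ^ 2 / √C) := by
  have hl2 := two_le_log hn hl
  have hnr : (1000 : ℝ) ≤ n := by exact_mod_cast hn
  have hsC : 1 ≤ √C := Real.one_le_sqrt.2 hC
  have hu0 : 0 < √C := by linarith
  have hX : (n : ℝ) ≤ n * √C := le_mul_of_one_le_right (by linarith) hsC
  have hd0 : 0 < d := by linarith
  have hc0 : 0 < c := by linarith
  have hR := regime_of_large hκ hB hd hC hn hl hfew
  set δ := Real.exp (-(B * l)) with hδ
  have hδ0 : 0 < δ := Real.exp_pos _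
  set ℓ := d * (κ + 3) * l + 1 with hℓ
  have hℓ0 : 0 ≤ ℓ := by positivity
  have hℓle : ℓ ≤ (d * (κ + 3) + 1) * l := by rw [hℓ]; linarith
  obtain ⟨J, hJ1, hJ2⟩ := exists_doublings hκ hl2
  have hMb : ∀ k ≤ N, ∀ s m, cabCost C c d M k s m ≤ 2 * M := fun k hk s m => by
    have h1 := costToGo_le (P := collisionAversionBackoff C c d) hM k s m
    have h2 : (k : ℝ) ≤ N := by exact_mod_cast hk
    exact h1.trans (by linarith)
  have hV0 : 0 ≤ runDownConst κ B c * (n * l / √C) := by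
    have : 0 ≤ runDownConst κ B c := by unfold runDownConst; positivity
    positivity
  have hT0 : 0 ≤ runDownTime κ c * (n * √C * l) := by
    have : 0 ≤ runDownTime κ c := by unfold runDownTime; positivity
    positivity
  have hrun := runDown_le (d := d) hκ hB hc hC hn hl hCn hM hMδ hMb
  have hmax := window_le_exp hC hn hl hCn
  have hJloss : 9 / 10 * (n : ℝ) + (J + 1) * (3 * √n * ℓ) ≤ n := by
    have h1 : ((J : ℝ) + 1) * (3 * √n * ℓ) ≤
        2 * (κ + 4) * l * (3 * √n * ((d * (κ + 3) + 1) * l)) := by gcongr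
    linarith
  have hlog_le : l ≤ n := by rw [hl]; exact Real.log_le_self (by linarith)
  have hJtime : ((J : ℝ) + 1) * (√C * ℓ) + runDownTime κ c * (n * √C * l) ≤ N := by
    have h1 : ((J : ℝ) + 1) * (√C * ℓ) ≤
        2 * (κ + 4) * (d * (κ + 3) + 1) * (n * √C * l) := by
      calc ((J : ℝ) + 1) * (√C * ℓ) ≤ 2 * (κ + 4) * l * (√C * ((d * (κ + 3) + 1) * l)) := by
            gcongr
        _ = 2 * (κ + 4) * (d * (κ + 3) + 1) * (l * √C * l) := by ring
        _ ≤ _ := by gcongr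
    have h2 : 1 ≤ n * √C * l :=
      one_le_mul_of_one_le_of_one_le (by linarith) (by linarith)
    have h3 := Nat.lt_floor_add_one (makespanConst κ c d * (n * √C * l))
    rw [← hN] at h3
    unfold makespanConst at h3
    linarith
  have hfinal : ((J : ℝ) + 1) * (ℓ * (n / √C) + 2 * M * (4 * δ)) +
      runDownConst κ B c * (n * l / √C) ≤ collisionConst κ B c d * (n * l ^ 2 / √C) := by
    have hMδ' : M * δ ≤ 1 / √C :=
      (le_mul_of_one_le_right (by positivity) (by linarith)).trans hMδ
    have h1 : 1 / √C ≤ l * (n / √C) := by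
      rw [mul_div_assoc']
      gcongr
      exact one_le_mul_of_one_le_of_one_le (by linarith) (by linarith)
    have h2 : ℓ * (n / √C) + 2 * M * (4 * δ) ≤ (d * (κ + 3) + 9) * (l * (n / √C)) := by
      have h3 : ℓ * (n / √C) ≤ (d * (κ + 3) + 1) * l * (n / √C) := by gcongr
      linarith
    have h4 : ((J : ℝ) + 1) * (ℓ * (n / √C) + 2 * M * (4 * δ)) ≤
        2 * (κ + 4) * l * ((d * (κ + 3) + 9) * (l * (n / √C))) :=
      mul_le_mul hJ2 h2 (by positivity) (by positivity)
    have h5 : n * l / √C ≤ n * l ^ 2 / √C := by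
      rw [sq]
      gcongr
      exact le_mul_of_one_le_right (by linarith) (by linarith)
    have h6 : runDownConst κ B c * (n * l / √C) ≤ runDownConst κ B c * (n * l ^ 2 / √C) := by
      have : 0 ≤ runDownConst κ B c := by unfold runDownConst; positivity
      gcongr
    unfold collisionConst
    calc _ ≤ 2 * (κ + 4) * l * ((d * (κ + 3) + 9) * (l * (n / √C))) +
          runDownConst κ B c * (n * l ^ 2 / √C) := add_le_add h4 h6
      _ = _ := by ring
  obtain ⟨w, hstart, hCw, hw1, hwC⟩ := exists_start C d hC
  rw [hstart]
  refine le_trans ?_ hfinal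
  have hwmax : w ≤ Real.exp ((κ + 3) * l) := by
    rcases hwC with h | h
    · rw [h]
      exact hCn.trans (Real.exp_le_exp.2 (by linarith))
    · rw [h]
      linarith
  rcases lt_or_ge w (512 * (n * √C)) with hw | hw
  · refine search_up hR hδ0.le hM (by linarith) hMb hV0 hT0 hrun (by linarith) J w n N hCw hw1 hw
      ?_ hJloss le_rfl hJtime le_rfl
    have h1 : 512 * (n * √C) ≤ (2 : ℝ) ^ J := by linarith
    exact h1.trans (le_mul_of_one_le_right (by positivity) hw1.le)
  · refine search_down hR hδ0.le hM (by linarith) hMb hV0 hT0 hrun J w n N hw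
      ?_ hwmax hJloss le_rfl hJtime le_rfl
    exact (hwmax.trans hJ1).trans (le_mul_of_one_le_right (by positivity) (by linarith))

end Constants

/-! ### From the cost-to-go to makespan and collision cost -/

open Filter Asymptotics in
/-- What "sufficiently many packets" has to mean. -/
lemma exists_large (B a K : ℝ) (hB : 1 ≤ B) (ha : 0 < a) : ∃ n₀ : ℕ, ∀ n : ℕ, n₀ ≤ n →
    1100 ≤ n ∧ K ≤ n ∧ 3 * Real.exp (-(√(n : ℝ) / 4 / 2)) ≤ Real.exp (-(B * Real.log n)) ∧
      a * Real.log n ^ 2 ≤ √(n : ℝ) := by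
  have h1 : ∀ᶠ x : ℝ in atTop, Real.log x ≤ 1 / (16 * B) * √x := by
    have := (isLittleO_log_rpow_atTop (r := 1 / 2) (by norm_num)).bound
      (c := 1 / (16 * B)) (by positivity)
    filter_upwards [this, eventually_ge_atTop 1] with x hx h1
    rw [Real.norm_eq_abs, Real.norm_eq_abs, abs_of_nonneg (Real.log_nonneg h1),
      abs_of_nonneg (by positivity), ← Real.sqrt_eq_rpow] at hx
    exact hx
  have h2 : ∀ᶠ x : ℝ in atTop, Real.log x ^ 2 ≤ 1 / a * √x := by
    have := (isLittleO_log_rpow_rpow_atTop (2 : ℝ) (s := 1 / 2) (by norm_num)).bound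
      (c := 1 / a) (by positivity)
    filter_upwards [this, eventually_ge_atTop 1] with x hx h1
    rw [Real.norm_eq_abs, Real.norm_eq_abs, abs_of_nonneg (Real.rpow_nonneg (Real.log_nonneg h1) _),
      abs_of_nonneg (by positivity), ← Real.sqrt_eq_rpow, Real.rpow_two] at hx
    exact hx
  have h3 := tendsto_natCast_atTop_atTop.eventually
    (h1.and (h2.and ((eventually_ge_atTop 1100).and (eventually_ge_atTop K))))
  obtain ⟨n₀, hn₀⟩ := eventually_atTop.1 h3
  refine ⟨n₀, fun n hn => ?_⟩
  obtain ⟨a1, a2, a3, a4⟩ := hn₀ n hn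
  refine ⟨by exact_mod_cast a3, a4, ?_, ?_⟩
  · have h5 : 32 ≤ √(n : ℝ) := Real.le_sqrt_of_sq_le (by linarith)
    have h6 : B * Real.log n ≤ √(n : ℝ) / 16 := by
      have := mul_le_mul_of_nonneg_left a1 (by linarith : 0 ≤ B)
      have e : B * (1 / (16 * B) * √(n : ℝ)) = √(n : ℝ) / 16 := by field_simp
      linarith
    have h7 : (3 : ℝ) ≤ Real.exp 2 := by linarith [Real.add_one_le_exp (2 : ℝ)]
    calc 3 * Real.exp (-(√(n : ℝ) / 4 / 2)) ≤ Real.exp 2 * Real.exp (-(√(n : ℝ) / 4 / 2)) := by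
          gcongr
      _ = Real.exp (2 + -(√(n : ℝ) / 4 / 2)) := by rw [Real.exp_add]
      _ ≤ _ := Real.exp_le_exp.2 (by linarith)
  · have := mul_le_mul_of_nonneg_left a2 ha.le
    have e : a * (1 / a * √(n : ℝ)) = √(n : ℝ) := by field_simp
    linarith

lemma lintegral_cond_le {Ω : Type*} [MeasurableSpace Ω] (μ : Measure Ω) {s : Set Ω}
    (hs : MeasurableSet s) {f : Ω → ℝ≥0∞} {a : ℝ≥0∞} (h : ∀ ω ∈ s, f ω ≤ a) :
    ∫⁻ ω, f ω ∂(μ[|s]) ≤ a := by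
  rw [ProbabilityTheory.cond, lintegral_smul_measure, smul_eq_mul]
  calc (μ s)⁻¹ * ∫⁻ ω in s, f ω ∂μ ≤ (μ s)⁻¹ * ∫⁻ _ω in s, a ∂μ := by
        gcongr 1
        exact setLIntegral_mono' hs h
    _ = a * ((μ s)⁻¹ * μ s) := by rw [setLIntegral_const]; ring
    _ ≤ a * 1 := by
        gcongr
        exact ENNReal.inv_mul_le_one _
    _ = a := mul_one a

/-- A bound for the cost-to-go with penalty `M` bounds the probability of unfinished executions and
the expected collision cost of the finished ones. -/
lemma bounds_of_costToGo_le (P : Protocol) {M W C : ℝ} (hM : 0 < M) (hC : 0 ≤ C) (hW : 0 ≤ W)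
    (n N : ℕ) (h : costToGo P M N P.start n ≤ W) :
    1 - W / M ≤ (coinMeasure n).real {ω | (traj P ω N).2 = ∅} ∧
      ∫⁻ ω in {ω | (traj P ω N).2 = ∅}, collisionCost P C ω ∂coinMeasure n ≤
        ENNReal.ofReal (C * W) := by
  have hsum := sum_collisions_add_penalty P hM.le n N
  have hW' := ENNReal.ofReal_le_ofReal h
  rw [← hsum] at hW'
  constructor
  · have hc : {ω : Coins n | (traj P ω N).2 = ∅} = {ω : Coins n | (traj P ω N).2 ≠ ∅}ᶜ := by
      ext ω; simp
    have hm : MeasurableSet {ω : Coins n | (traj P ω N).2 ≠ ∅} :=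
      (measurableSet_finished P n N).compl
    rw [hc, probReal_compl_eq_one_sub hm]
    have h1 : ENNReal.ofReal M * coinMeasure n {ω | (traj P ω N).2 ≠ ∅} ≤ ENNReal.ofReal W :=
      le_trans le_add_self hW'
    have h2 := ENNReal.toReal_mono ENNReal.ofReal_ne_top h1
    rw [ENNReal.toReal_mul, ENNReal.toReal_ofReal hM.le, ENNReal.toReal_ofReal hW] at h2
    have h3 : (coinMeasure n).real {ω | (traj P ω N).2 ≠ ∅} ≤ W / M := by
      rw [le_div_iff₀ hM, mul_comm]
      exact h2
    linarith
  · refine (setLIntegral_collisionCost_le P C n N).trans ?_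
    rw [ENNReal.ofReal_mul hC]
    gcongr
    exact le_trans le_self_add hW'

end ContentionResolution

open ContentionResolution
/-- For a tunable error exponent `A` and all sufficiently large constants `d`, `c` of the algorithm:
with probability `1 - O(1 / n ^ A)`, all `n` packets succeed with makespan `O(n √C log n)`, and the
expected total collision cost, given this event, is `O(n √C log² n)`. -/
theorem theorem1 (κ A : ℝ) (hκ : 0 ≤ κ) (hA : 1 ≤ A) :
    ∃ d₀ c₀ : ℝ, ∀ d c : ℝ, d₀ ≤ d → c₀ ≤ c →
      ∃ K₁ K₂ K₃ : ℝ, ∀ n : ℕ, 2 ≤ n → ∀ C : ℝ, 1 ≤ C → C ≤ (n : ℝ) ^ κ →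
        let good : Set (Coins n) := {ω |
          ((makespan (collisionAversionBackoff C c d) ω : ℕ∞) : ℝ≥0∞) ≤
            ENNReal.ofReal (K₁ * (n * √C * Real.log n))}
        1 - K₂ / (n : ℝ) ^ A ≤ (coinMeasure n).real good ∧
          ∫⁻ ω, collisionCost (collisionAversionBackoff C c d) C ω ∂((coinMeasure n)[|good]) ≤
            ENNReal.ofReal (K₃ * (n * √C * Real.log n ^ 2)) := by
  set B := A + 2 * κ + 4 with hBdef
  have hB : 1 ≤ B := by linarith
  refine ⟨2 * 10 ^ 5 * B, B, fun d c hd hc => ?_⟩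
  have hd0 : 0 < d := by linarith
  have hc0 : 0 < c := by linarith
  set K₁ := makespanConst κ c d with hK₁
  set Kc := collisionConst κ B c d with hKc
  have hK₁0 : 0 ≤ K₁ := by
    rw [hK₁]; unfold makespanConst runDownTime; positivity
  have hKc0 : 0 ≤ Kc := by
    rw [hKc]; unfold collisionConst runDownConst; positivity
  obtain ⟨n₀, hn₀⟩ := exists_large B (60 * (κ + 4) * (d * (κ + 3) + 1)) (max K₁ (2 * Kc)) hB
    (by positivity)
  refine ⟨K₁, (n₀ : ℝ) ^ A + Kc, 2 * Kc + (n₀ : ℝ) ^ κ * K₁ / Real.log 2,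
    fun n hn C hC hCn => ?_⟩
  intro good
  have hn2 : (2 : ℝ) ≤ n := by exact_mod_cast hn
  have hn0 : (0 : ℝ) < n := by linarith
  set P := collisionAversionBackoff C c d with hP
  set l := Real.log n with hl
  have hl0 : 0 < l := Real.log_pos (by linarith)
  have hsC : 1 ≤ √C := Real.one_le_sqrt.2 hC
  have hlog2 : 0 < Real.log 2 := Real.log_pos one_lt_two
  set N := ⌊K₁ * (n * √C * l)⌋₊ with hN
  have hx0 : 0 ≤ K₁ * (n * √C * l) := by positivity
  have hgood : good = {ω | (traj P ω N).2 = ∅} := by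
    ext ω
    exact makespan_le_ofReal_iff P ω hx0
  have hNle : (N : ℝ) ≤ K₁ * (n * √C * l) := Nat.floor_le hx0
  have hnA0 : 0 < (n : ℝ) ^ A := Real.rpow_pos_of_pos hn0 A
  have hK₃ : 0 ≤ (n₀ : ℝ) ^ κ * K₁ / Real.log 2 := by positivity
  -- For `n < n₀`, the bound for the probability is vacuous and every slot may be a collision.
  rcases lt_or_ge n n₀ with hsmall | hlarge
  · have hnn : (n : ℝ) ≤ n₀ := by exact_mod_cast hsmall.le
    constructor
    · have h1 : (n : ℝ) ^ A ≤ (n₀ : ℝ) ^ A + Kc := by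
        have := Real.rpow_le_rpow hn0.le hnn (by linarith : 0 ≤ A)
        linarith
      have h2 : 1 ≤ ((n₀ : ℝ) ^ A + Kc) / (n : ℝ) ^ A := by rwa [one_le_div hnA0]
      have h3 : 0 ≤ (coinMeasure n).real good := measureReal_nonneg
      linarith
    · rw [hgood]
      refine lintegral_cond_le _ (measurableSet_finished P n N) fun ω hω => ?_
      refine (collisionCost_le P C ω hω).trans ?_
      rw [← ENNReal.ofReal_natCast, ← ENNReal.ofReal_mul (by linarith)]
      refine ENNReal.ofReal_le_ofReal ?_
      have h1 : C ≤ (n₀ : ℝ) ^ κ := hCn.trans (Real.rpow_le_rpow hn0.le hnn hκ)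
      have h2 : l ≤ l ^ 2 / Real.log 2 := by
        rw [le_div_iff₀ hlog2, sq]
        exact mul_le_mul_of_nonneg_left (Real.log_le_log two_pos hn2) hl0.le
      calc C * N ≤ (n₀ : ℝ) ^ κ * (K₁ * (n * √C * (l ^ 2 / Real.log 2))) := by
            refine mul_le_mul h1 (hNle.trans ?_) (by positivity) (by positivity)
            gcongr
        _ = (n₀ : ℝ) ^ κ * K₁ / Real.log 2 * (n * √C * l ^ 2) := by ring
        _ ≤ _ := mul_le_mul_of_nonneg_right (by linarith) (by positivity)
  · obtain ⟨hn1100, hKn, hfew, hloss⟩ := hn₀ n hlarge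
    have hn1000 : 1000 ≤ n := by omega
    have hK₁n : K₁ ≤ n := (le_max_left _ _).trans hKn
    have hKcn : 2 * Kc ≤ n := (le_max_right _ _).trans hKn
    have hexp : Real.exp l = n := exp_log_natCast hn1000 hl
    have hln : l ≤ n := Real.log_le_self hn0.le
    have hCexp : C ≤ Real.exp (κ * l) := by
      rw [Real.rpow_def_of_pos hn0] at hCn
      rwa [mul_comm]
    have hsCexp := sqrt_le_exp hC hCexp
    have hu0 : 0 < √C := by linarith
    -- The penalty exceeds the number of slots and is small against the inverse error probability.
    set M := Real.exp ((A + κ + 3) * l) with hM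
    have hM0 : 0 < M := Real.exp_pos _
    have hMδ : M * Real.exp (-(B * l)) * n ≤ 1 / √C := by
      rw [le_div_iff₀ hu0]
      calc M * Real.exp (-(B * l)) * n * √C
          ≤ M * Real.exp (-(B * l)) * n * Real.exp (κ * l) := by gcongr
        _ = Real.exp ((A + κ + 3) * l + -(B * l) + l + κ * l) := by
            rw [Real.exp_add, Real.exp_add, Real.exp_add, hexp]
        _ = 1 := by rw [hBdef, ← Real.exp_zero]; congr 1; ring
    have hNM : (N : ℝ) ≤ M := by
      refine hNle.trans ?_
      calc K₁ * (n * √C * l) ≤ n * (n * Real.exp (κ * l) * n) := by gcongr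
        _ = Real.exp (l + (l + κ * l + l)) := by
            rw [Real.exp_add l, Real.exp_add _ l, Real.exp_add, hexp]
        _ ≤ M := Real.exp_le_exp.2 (by nlinarith)
    have hloss' : 2 * (κ + 4) * l * (3 * √(n : ℝ) * ((d * (κ + 3) + 1) * l)) ≤ n / 10 := by
      have h1 := mul_le_mul_of_nonneg_left hloss (Real.sqrt_nonneg (n : ℝ))
      rw [Real.mul_self_sqrt hn0.le] at h1
      linarith
    have hmain := cabCost_start_le hκ hB hc hd hC hn1000 hl hCexp hM0.le hMδ hfew hloss' hN hNM
    obtain ⟨hprob, hcost⟩ := bounds_of_costToGo_le P hM0 (by linarith : 0 ≤ C)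
      (by positivity) n N hmain
    rw [← hgood] at hprob hcost
    have hWM : Kc * (n * l ^ 2 / √C) / M ≤ Kc / (n : ℝ) ^ A := by
      rw [div_le_div_iff₀ hM0 hnA0]
      have h1 : n * l ^ 2 / √C ≤ (n : ℝ) ^ 3 := by
        calc n * l ^ 2 / √C ≤ n * l ^ 2 / 1 := by gcongr
          _ ≤ n * (n : ℝ) ^ 2 / 1 := by gcongr
          _ = (n : ℝ) ^ 3 := by ring
      have h2 : (n : ℝ) ^ 3 * (n : ℝ) ^ A ≤ M := by
        have e : (n : ℝ) ^ A = Real.exp (A * l) := by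
          rw [Real.rpow_def_of_pos hn0, mul_comm]
        rw [e, ← hexp, ← Real.exp_nat_mul, ← Real.exp_add]
        refine Real.exp_le_exp.2 ?_
        push_cast
        nlinarith
      calc Kc * (n * l ^ 2 / √C) * (n : ℝ) ^ A ≤ Kc * (n : ℝ) ^ 3 * (n : ℝ) ^ A := by gcongr
        _ = Kc * ((n : ℝ) ^ 3 * (n : ℝ) ^ A) := by ring
        _ ≤ Kc * M := by gcongr
    have hprob' : 1 - Kc / (n : ℝ) ^ A ≤ (coinMeasure n).real good := by linarith
    constructor
    · refine le_trans ?_ hprob'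
      have : Kc / (n : ℝ) ^ A ≤ ((n₀ : ℝ) ^ A + Kc) / (n : ℝ) ^ A := by
        gcongr
        have : 0 ≤ (n₀ : ℝ) ^ A := by positivity
        linarith
      linarith
    · have hhalf : ENNReal.ofReal (1 / 2) ≤ coinMeasure n good := by
        rw [ENNReal.ofReal_le_iff_le_toReal (measure_ne_top _ _)]
        have h1 : Kc / (n : ℝ) ^ A ≤ 1 / 2 := by
          rw [div_le_div_iff₀ hnA0 two_pos]
          have : (n : ℝ) ≤ (n : ℝ) ^ A := Real.self_le_rpow_of_one_le (by linarith) hA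
          linarith
        have : (coinMeasure n).real good = (coinMeasure n good).toReal := rfl
        linarith
      have hinv : (coinMeasure n good)⁻¹ ≤ ENNReal.ofReal 2 := by
        have h1 := ENNReal.inv_le_inv.2 hhalf
        rw [← ENNReal.ofReal_inv_of_pos (by norm_num)] at h1
        norm_num at h1 ⊢
        exact h1
      rw [ProbabilityTheory.cond, lintegral_smul_measure, smul_eq_mul]
      calc (coinMeasure n good)⁻¹ * ∫⁻ ω in good, collisionCost P C ω ∂coinMeasure n
          ≤ ENNReal.ofReal 2 * ENNReal.ofReal (C * (Kc * (n * l ^ 2 / √C))) := by gcongr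
        _ = ENNReal.ofReal (2 * (C * (Kc * (n * l ^ 2 / √C)))) := by
            rw [← ENNReal.ofReal_mul two_pos.le]
        _ ≤ _ := ENNReal.ofReal_le_ofReal (by
            have e : 2 * (C * (Kc * (n * l ^ 2 / √C))) = 2 * Kc * (n * √C * l ^ 2) := by
              have : C = √C * √C := (Real.mul_self_sqrt (by linarith)).symm
              nth_rw 1 [this]
              field_simp
            rw [e]
            exact mul_le_mul_of_nonneg_right (by linarith) (by positivity))
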